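/- **Theorem 2.4.** Let $(M^n,g)$, $n\ge 1$, be a compact smooth Riemannian manifold with smooth (possibly empty) boundary $\partial M$ and with nonnegative Ricci curvature, $\mathrm{Rc}\ge 0$. Let $\lambda>0$ and let $u\in C^\infty(M)$ be real-valued with $$\Delta u=-\lambda u \ \text{ on } M,\qquad \max_{x\in M}|u(x)|=1 .$$ Let $\vec n$ denote the outward unit normal on $\partial M$. Assume that one of the following holds: * $\partial M$ is convex, that is, $\langle\nabla_v\vec n,v\rangle\ge 0$ for all $v$ tangent to $\partial M$, and $\frac{\partial u}{\partial\vec n}=0$ on $\partial M$; or * $\partial M$ is mean convex, that is, $\sum_{i=1}^{n-1}\langle\nabla_{e_i}\vec n,e_i\rangle\ge 0$ for every orthonormal basis $e_1,\dots,e_{n-1}$ of a tangent space of $\partial M$, and $u=0$ on $\partial M$. Then at every point of $M$ $$|\nabla u|^2+\lambda u^2\le\lambda .$$ -/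

import Mathlib

open scoped Manifold ContDiff

noncomputable section

namespace LiYau

/-! ### Local Riemannian geometry in the half-space

In this part `G z` is the matrix `(g_{ij}(z))` of a Riemannian metric in local coordinates
`z = (z^0, …, z^{n-1})` with values in the half-space `{z^0 ≥ 0}`. -/

/-- The partial derivative `∂_i f (z)`, taken within the closed half-space `{z^0 ≥ 0}`
(so it is one-sided at points of the hyperplane `{z^0 = 0}`). -/
def partialDeriv {n : ℕ} [NeZero n] (i : Fin n) (f : EuclideanSpace ℝ (Fin n) → ℝ)
    (z : EuclideanSpace ℝ (Fin n)) : ℝ :=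
  fderivWithin ℝ f (Set.range (𝓡∂ n)) z (EuclideanSpace.single i 1)

/-- The Christoffel symbol
`Γ^k_{ij} = (1/2) ∑_l g^{kl} (∂_i g_{jl} + ∂_j g_{il} - ∂_l g_{ij})`. -/
def christoffel {n : ℕ} [NeZero n]
    (G : EuclideanSpace ℝ (Fin n) → Matrix (Fin n) (Fin n) ℝ) (k i j : Fin n)
    (z : EuclideanSpace ℝ (Fin n)) : ℝ :=
  (1 / 2) * ∑ l, (G z)⁻¹ k l *
    (partialDeriv i (fun y => G y j l) z + partialDeriv j (fun y => G y i l) z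
      - partialDeriv l (fun y => G y i j) z)

/-- The Ricci tensor
`R_{jk} = ∑_i (∂_i Γ^i_{jk} - ∂_j Γ^i_{ik}) + ∑_{i,p} (Γ^i_{ip} Γ^p_{jk} - Γ^i_{jp} Γ^p_{ik})`
(positive on round spheres). -/
def ricciCoord {n : ℕ} [NeZero n]
    (G : EuclideanSpace ℝ (Fin n) → Matrix (Fin n) (Fin n) ℝ) (j k : Fin n)
    (z : EuclideanSpace ℝ (Fin n)) : ℝ :=
  ∑ i, (partialDeriv i (christoffel G i j k) z - partialDeriv j (christoffel G i i k) z)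
    + ∑ i, ∑ p, (christoffel G i i p z * christoffel G p j k z
      - christoffel G i j p z * christoffel G p i k z)

/-- The Hessian `(∇²f)_{ij} = ∂_i ∂_j f - ∑_k Γ^k_{ij} ∂_k f`. -/
def hessianCoord {n : ℕ} [NeZero n]
    (G : EuclideanSpace ℝ (Fin n) → Matrix (Fin n) (Fin n) ℝ)
    (f : EuclideanSpace ℝ (Fin n) → ℝ) (i j : Fin n) (z : EuclideanSpace ℝ (Fin n)) : ℝ :=
  partialDeriv i (partialDeriv j f) z - ∑ k, christoffel G k i j z * partialDeriv k f z

/-- The Laplace-Beltrami operator `Δf = ∑_{i,j} g^{ij} (∇²f)_{ij}`. -/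
def laplacianCoord {n : ℕ} [NeZero n]
    (G : EuclideanSpace ℝ (Fin n) → Matrix (Fin n) (Fin n) ℝ)
    (f : EuclideanSpace ℝ (Fin n) → ℝ) (z : EuclideanSpace ℝ (Fin n)) : ℝ :=
  ∑ i, ∑ j, (G z)⁻¹ i j * hessianCoord G f i j z

/-- The components `ν^k = -g^{k0} / √g^{00}` of the unit vector field `-∇z^0 / |∇z^0|`. On the
hyperplane `{z^0 = 0}` this is the outward unit normal of the half-space `{z^0 ≥ 0}`. -/
def outwardNormal {n : ℕ} [NeZero n]
    (G : EuclideanSpace ℝ (Fin n) → Matrix (Fin n) (Fin n) ℝ) (k : Fin n)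
    (z : EuclideanSpace ℝ (Fin n)) : ℝ :=
  -((G z)⁻¹ k 0) / √((G z)⁻¹ 0 0)

/-- The numbers `⟨∇_{∂_i} ν, ∂_j⟩ = ∑_k (∂_i ν^k + ∑_l Γ^k_{il} ν^l) g_{kj}`. -/
def covDerivNormal {n : ℕ} [NeZero n]
    (G : EuclideanSpace ℝ (Fin n) → Matrix (Fin n) (Fin n) ℝ) (i j : Fin n)
    (z : EuclideanSpace ℝ (Fin n)) : ℝ :=
  ∑ k, (partialDeriv i (outwardNormal G k) z
    + ∑ l, christoffel G k i l z * outwardNormal G l z) * G z k j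

/-- The quadratic form `v ↦ ⟨∇_v ν, v⟩`, `v = ∑ v^i ∂_i`. On vectors tangent to the boundary
`{z^0 = 0}` (those with `v^0 = 0`) it is the second fundamental form with respect to the outward
unit normal, nonnegative when the domain is convex. -/
def secondFundamentalForm {n : ℕ} [NeZero n]
    (G : EuclideanSpace ℝ (Fin n) → Matrix (Fin n) (Fin n) ℝ) (v : Fin n → ℝ)
    (z : EuclideanSpace ℝ (Fin n)) : ℝ :=
  ∑ i, ∑ j, v i * v j * covDerivNormal G i j z

/-- The mean curvature of the boundary `{z^0 = 0}` with respect to the outward unit normal: the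
trace `∑_a ⟨∇_{e_a} ν, e_a⟩` over an orthonormal basis `e_1, …, e_{n-1}` of the tangent space of
the boundary, for which `∑_a e_a^i e_a^j = g^{ij} - ν^i ν^j`. -/
def meanCurvature {n : ℕ} [NeZero n]
    (G : EuclideanSpace ℝ (Fin n) → Matrix (Fin n) (Fin n) ℝ)
    (z : EuclideanSpace ℝ (Fin n)) : ℝ :=
  ∑ i, ∑ j, ((G z)⁻¹ i j - outwardNormal G i z * outwardNormal G j z) * covDerivNormal G i j z

/-! ### Smooth Riemannian manifolds with boundary -/

/-- A smooth Riemannian metric on the `n`-dimensional manifold with boundary `M`. -/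
abbrev Metric (n : ℕ) [NeZero n] (M : Type*) [TopologicalSpace M]
    [ChartedSpace (EuclideanHalfSpace n) M] [IsManifold (𝓡∂ n) ∞ M] :=
  Bundle.ContMDiffRiemannianMetric (𝓡∂ n) ∞ (EuclideanSpace ℝ (Fin n))
    (fun x : M => TangentSpace (𝓡∂ n) x)

variable {n : ℕ} [NeZero n] {M : Type*} [TopologicalSpace M]
  [ChartedSpace (EuclideanHalfSpace n) M] [IsManifold (𝓡∂ n) ∞ M]

/-- The expression of a function on `M` in the chart `e`. -/
def coordFun (e : OpenPartialHomeomorph M (EuclideanHalfSpace n)) (u : M → ℝ) :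
    EuclideanSpace ℝ (Fin n) → ℝ :=
  fun z => u ((e.extend (𝓡∂ n)).symm z)

/-- The coordinate vector field `∂_i` of the chart `e`, at the point with coordinates `z`. -/
def coordVector (e : OpenPartialHomeomorph M (EuclideanHalfSpace n)) (i : Fin n)
    (z : EuclideanSpace ℝ (Fin n)) : TangentSpace (𝓡∂ n) ((e.extend (𝓡∂ n)).symm z) :=
  mfderivWithin 𝓘(ℝ, EuclideanSpace ℝ (Fin n)) (𝓡∂ n) (e.extend (𝓡∂ n)).symm
    (Set.range (𝓡∂ n)) z (EuclideanSpace.single i (1 : ℝ) : EuclideanSpace ℝ (Fin n))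

/-- The matrix `g_{ij} = g(∂_i, ∂_j)` of the metric in the chart `e`. -/
def coordMetric (g : Metric n M) (e : OpenPartialHomeomorph M (EuclideanHalfSpace n)) :
    EuclideanSpace ℝ (Fin n) → Matrix (Fin n) (Fin n) ℝ :=
  fun z => Matrix.of fun i j =>
    g.inner ((e.extend (𝓡∂ n)).symm z) (coordVector e i z) (coordVector e j z)

/-- `Rc ≥ 0`: in all smooth charts, `∑ R_{jk} v^j v^k ≥ 0` for all tangent vectors. -/
def NonnegRicci (g : Metric n M) : Prop :=
  ∀ e ∈ IsManifold.maximalAtlas (𝓡∂ n) ∞ M, ∀ p ∈ e.source, ∀ v : Fin n → ℝ,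
    0 ≤ ∑ j, ∑ k, ricciCoord (coordMetric g e) j k (e.extend (𝓡∂ n) p) * v j * v k

/-- `Δu = -lam • u` on `M`: the equation holds in all smooth charts, at all points (up to the
boundary). -/
def IsEigenfunction (g : Metric n M) (lam : ℝ) (u : M → ℝ) : Prop :=
  ∀ e ∈ IsManifold.maximalAtlas (𝓡∂ n) ∞ M, ∀ p ∈ e.source,
    laplacianCoord (coordMetric g e) (coordFun e u) (e.extend (𝓡∂ n) p) = -lam * u p

/-- The boundary is convex: its second fundamental form with respect to the outward unit normal
is nonnegative at all vectors tangent to the boundary. -/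
def ConvexBoundary (g : Metric n M) : Prop :=
  ∀ e ∈ IsManifold.maximalAtlas (𝓡∂ n) ∞ M, ∀ p ∈ e.source, p ∈ (𝓡∂ n).boundary M →
    ∀ v : Fin n → ℝ, v 0 = 0 →
      0 ≤ secondFundamentalForm (coordMetric g e) v (e.extend (𝓡∂ n) p)

/-- The boundary is mean convex: its mean curvature with respect to the outward unit normal is
nonnegative. -/
def MeanConvexBoundary (g : Metric n M) : Prop :=
  ∀ e ∈ IsManifold.maximalAtlas (𝓡∂ n) ∞ M, ∀ p ∈ e.source, p ∈ (𝓡∂ n).boundary M →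
    0 ≤ meanCurvature (coordMetric g e) (e.extend (𝓡∂ n) p)

/-- The Neumann condition `∂u/∂ν = 0` on the boundary. -/
def NeumannCondition (g : Metric n M) (u : M → ℝ) : Prop :=
  ∀ e ∈ IsManifold.maximalAtlas (𝓡∂ n) ∞ M, ∀ p ∈ e.source, p ∈ (𝓡∂ n).boundary M →
    ∑ k, outwardNormal (coordMetric g e) k (e.extend (𝓡∂ n) p)
      * partialDeriv k (coordFun e u) (e.extend (𝓡∂ n) p) = 0

/-- The differential of `u` is represented by a (unique) tangent vector. -/
theorem exists_gradient (g : Metric n M) (u : M → ℝ) (x : M) :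
    ∃ N : TangentSpace (𝓡∂ n) x, ∀ v : TangentSpace (𝓡∂ n) x,
      g.inner x N v = (mfderiv (𝓡∂ n) 𝓘(ℝ, ℝ) u x v : ℝ) := by
  have : FiniteDimensional ℝ (TangentSpace (𝓡∂ n) x) :=
    inferInstanceAs (FiniteDimensional ℝ (EuclideanSpace ℝ (Fin n)))
  let L : TangentSpace (𝓡∂ n) x →ₗ[ℝ] Module.Dual ℝ (TangentSpace (𝓡∂ n) x) :=
    { toFun := fun v => (g.inner x v).toLinearMap
      map_add' := fun a b => by ext w; simp
      map_smul' := fun a b => by ext w; simp }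
  have hL : Function.Injective L := by
    rw [injective_iff_map_eq_zero]
    intro v hv
    by_contra h
    have h1 := g.pos x v h
    have h2 : g.inner x v v = 0 := LinearMap.congr_fun hv v
    exact absurd h2 h1.ne'
  have hS : Function.Surjective L :=
    (LinearMap.injective_iff_surjective_of_finrank_eq_finrank
      Subspace.dual_finrank_eq.symm).1 hL
  obtain ⟨N, hN⟩ := hS (mfderiv (𝓡∂ n) 𝓘(ℝ, ℝ) u x).toLinearMap
  exact ⟨N, fun v => LinearMap.congr_fun hN v⟩

/-- The gradient `∇u`, characterized by `g(∇u, v) = du(v)` for all tangent vectors `v`. -/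
def gradient (g : Metric n M) (u : M → ℝ) (x : M) : TangentSpace (𝓡∂ n) x :=
  (exists_gradient g u x).choose

theorem inner_gradient (g : Metric n M) (u : M → ℝ) (x : M) (v : TangentSpace (𝓡∂ n) x) :
    g.inner x (gradient g u x) v = (mfderiv (𝓡∂ n) 𝓘(ℝ, ℝ) u x v : ℝ) :=
  (exists_gradient g u x).choose_spec v

/-- `|∇u|²`. -/
def gradNormSq (g : Metric n M) (u : M → ℝ) (x : M) : ℝ :=
  g.inner x (gradient g u x) (gradient g u x)

end LiYau

end

noncomputable section

namespace LiYau

open Set Filter Topology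

section HalfSpaceCalculus

variable {n : ℕ} [NeZero n] {S : Set (EuclideanSpace ℝ (Fin n))}
  {f h : EuclideanSpace ℝ (Fin n) → ℝ} {z : EuclideanSpace ℝ (Fin n)}

/-- `S` is a relatively open subset of the closed half-space. -/
structure IsRelOpen (S : Set (EuclideanSpace ℝ (Fin n))) : Prop where
  subset : S ⊆ range (𝓡∂ n)
  mem_nhdsWithin : ∀ z ∈ S, S ∈ 𝓝[range (𝓡∂ n)] z

theorem range_halfSpace : range (𝓡∂ n) = {y : EuclideanSpace ℝ (Fin n) | 0 ≤ y 0} :=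
  range_modelWithCornersEuclideanHalfSpace n

theorem IsRelOpen.contDiffWithinAt (hS : IsRelOpen S) (hf : ContDiffOn ℝ ∞ f S) (hz : z ∈ S) :
    ContDiffWithinAt ℝ ∞ f (range (𝓡∂ n)) z :=
  (hf z hz).mono_of_mem_nhdsWithin (hS.mem_nhdsWithin z hz)

theorem IsRelOpen.differentiableWithinAt (hS : IsRelOpen S) (hf : ContDiffOn ℝ ∞ f S)
    (hz : z ∈ S) : DifferentiableWithinAt ℝ f (range (𝓡∂ n)) z :=
  (hS.contDiffWithinAt hf hz).differentiableWithinAt (by simp)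

theorem IsRelOpen.uniqueDiffWithinAt (hS : IsRelOpen S) (hz : z ∈ S) :
    UniqueDiffWithinAt ℝ (range (𝓡∂ n)) z :=
  (𝓡∂ n).uniqueDiffOn z (hS.subset hz)

theorem IsRelOpen.contDiffOn_partialDeriv (hS : IsRelOpen S) (hf : ContDiffOn ℝ ∞ f S)
    (i : Fin n) : ContDiffOn ℝ ∞ (partialDeriv i f) S := by
  intro z hz
  have h := (hS.contDiffWithinAt hf hz).fderivWithin_right (m := ∞) (𝓡∂ n).uniqueDiffOn
    (by simp) (hS.subset hz)
  exact (h.clm_apply contDiffWithinAt_const).mono hS.subset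

theorem IsRelOpen.partialDeriv_congr (hS : IsRelOpen S) (hfh : EqOn f h S) (hz : z ∈ S)
    (i : Fin n) : partialDeriv i f z = partialDeriv i h z := by
  unfold partialDeriv
  rw [Filter.EventuallyEq.fderivWithin_eq (f₁ := f) (f := h) _ (hfh hz)]
  exact eventually_of_mem (hS.mem_nhdsWithin z hz) hfh

theorem partialDeriv_const (c : ℝ) (i : Fin n) : partialDeriv i (fun _ => c) z = 0 := by
  simp [partialDeriv]

theorem IsRelOpen.partialDeriv_add (hS : IsRelOpen S) (hf : ContDiffOn ℝ ∞ f S)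
    (hh : ContDiffOn ℝ ∞ h S) (hz : z ∈ S) (i : Fin n) :
    partialDeriv i (fun y => f y + h y) z = partialDeriv i f z + partialDeriv i h z := by
  unfold partialDeriv
  rw [fderivWithin_fun_add (hS.uniqueDiffWithinAt hz) (hS.differentiableWithinAt hf hz)
    (hS.differentiableWithinAt hh hz)]
  simp

theorem IsRelOpen.partialDeriv_mul (hS : IsRelOpen S) (hf : ContDiffOn ℝ ∞ f S)
    (hh : ContDiffOn ℝ ∞ h S) (hz : z ∈ S) (i : Fin n) :
    partialDeriv i (fun y => f y * h y) z
      = partialDeriv i f z * h z + f z * partialDeriv i h z := by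
  unfold partialDeriv
  rw [fderivWithin_fun_mul (hS.uniqueDiffWithinAt hz) (hS.differentiableWithinAt hf hz)
    (hS.differentiableWithinAt hh hz)]
  simp
  ring

theorem IsRelOpen.partialDeriv_const_mul (hS : IsRelOpen S) (c : ℝ) (hf : ContDiffOn ℝ ∞ f S)
    (hz : z ∈ S) (i : Fin n) :
    partialDeriv i (fun y => c * f y) z = c * partialDeriv i f z := by
  rw [hS.partialDeriv_mul contDiffOn_const hf hz, partialDeriv_const]
  ring

theorem IsRelOpen.partialDeriv_sum (hS : IsRelOpen S) {ι : Type*} [Fintype ι]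
    {F : ι → EuclideanSpace ℝ (Fin n) → ℝ}
    (hF : ∀ a, ContDiffOn ℝ ∞ (F a) S) (hz : z ∈ S) (i : Fin n) :
    partialDeriv i (fun y => ∑ a, F a y) z = ∑ a, partialDeriv i (F a) z := by
  unfold partialDeriv
  rw [fderivWithin_fun_sum (hS.uniqueDiffWithinAt hz)
    fun a _ => hS.differentiableWithinAt (hF a) hz]
  simp

theorem mem_closure_interior_halfSpace (hz : z ∈ range (𝓡∂ n)) :
    z ∈ closure (interior (range (𝓡∂ n))) := by
  rw [(𝓡∂ n).convex_range.closure_interior_eq_closure_of_nonempty_interior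
    (𝓡∂ n).nonempty_interior]
  exact subset_closure hz

theorem IsRelOpen.partialDeriv_partialDeriv (hS : IsRelOpen S) (hf : ContDiffOn ℝ ∞ f S)
    (hz : z ∈ S) (i j : Fin n) :
    partialDeriv i (partialDeriv j f) z
      = fderivWithin ℝ (fderivWithin ℝ f (range (𝓡∂ n))) (range (𝓡∂ n)) z
          (EuclideanSpace.single i 1) (EuclideanSpace.single j 1) := by
  have h := (hS.contDiffWithinAt hf hz).fderivWithin_right (m := ∞) (𝓡∂ n).uniqueDiffOn
    (by simp) (hS.subset hz)
  have hd := h.differentiableWithinAt (by simp)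
  change fderivWithin ℝ (fun y => fderivWithin ℝ f (range (𝓡∂ n)) y
    (EuclideanSpace.single j 1)) _ z _ = _
  rw [fderivWithin_clm_apply (hS.uniqueDiffWithinAt hz) hd (differentiableWithinAt_const _)]
  simp

theorem IsRelOpen.partialDeriv_comm (hS : IsRelOpen S) (hf : ContDiffOn ℝ ∞ f S)
    (hz : z ∈ S) (i j : Fin n) :
    partialDeriv i (partialDeriv j f) z = partialDeriv j (partialDeriv i f) z := by
  rw [hS.partialDeriv_partialDeriv hf hz, hS.partialDeriv_partialDeriv hf hz]
  exact (hS.contDiffWithinAt hf hz).isSymmSndFDerivWithinAt (by simp; exact WithTop.coe_le_coe.2 le_top) (𝓡∂ n).uniqueDiffOn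
    (mem_closure_interior_halfSpace (hS.subset hz)) (hS.subset hz) _ _

theorem fderivWithin_eq_sum_partialDeriv (v : EuclideanSpace ℝ (Fin n)) :
    fderivWithin ℝ f (range (𝓡∂ n)) z v = ∑ i, v i * partialDeriv i f z := by
  have hv : v = ∑ i, v i • EuclideanSpace.single i (1 : ℝ) := by
    ext j
    simp [Finset.sum_apply, Pi.single_apply]
  conv_lhs => rw [hv]
  simp [partialDeriv]

/-! #### Maxima in the half-space -/

theorem IsRelOpen.eventually_ray_mem (hS : IsRelOpen S) (hz : z ∈ S)
    {v : EuclideanSpace ℝ (Fin n)} (hv : 0 < z 0 ∨ 0 ≤ v 0) :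
    ∀ᶠ t : ℝ in 𝓝[≥] 0, z + t • v ∈ S := by
  have hc : Tendsto (fun t : ℝ => z + t • v) (𝓝[≥] 0) (𝓝 z) := by
    have : Continuous fun t : ℝ => z + t • v := by fun_prop
    simpa using (this.tendsto 0).mono_left nhdsWithin_le_nhds
  have hz0 : z ∈ {y : EuclideanSpace ℝ (Fin n) | 0 ≤ y 0} := range_halfSpace (n := n) ▸ hS.subset hz
  have hz0 : 0 ≤ z 0 := hz0
  have hr : ∀ᶠ t : ℝ in 𝓝[≥] 0, z + t • v ∈ range (𝓡∂ n) := by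
    rw [range_halfSpace]
    rcases hv with h | h
    · have hc0 : Tendsto (fun t : ℝ => (z + t • v) 0) (𝓝[≥] 0) (𝓝 (z 0)) := by
        have : Continuous fun t : ℝ => (z + t • v) 0 := by simp; fun_prop
        simpa using (this.tendsto 0).mono_left nhdsWithin_le_nhds
      filter_upwards [hc0.eventually (lt_mem_nhds h)] with t ht using le_of_lt ht
    · filter_upwards [self_mem_nhdsWithin] with t ht
      have ht : 0 ≤ t := ht
      change 0 ≤ z 0 + t * v 0
      positivity
  exact (tendsto_nhdsWithin_iff.2 ⟨hc, hr⟩).eventually (hS.mem_nhdsWithin z hz)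

theorem IsRelOpen.sum_partialDeriv_nonpos (hS : IsRelOpen S) (hz : z ∈ S)
    (hmax : ∀ y ∈ S, f y ≤ f z) {v : EuclideanSpace ℝ (Fin n)} (hv : 0 < z 0 ∨ 0 ≤ v 0) :
    ∑ i, v i * partialDeriv i f z ≤ 0 := by
  rw [← fderivWithin_eq_sum_partialDeriv]
  have hm : IsLocalMaxOn f (range (𝓡∂ n)) z :=
    eventually_of_mem (hS.mem_nhdsWithin z hz) hmax
  refine hm.fderivWithin_nonpos (mem_posTangentConeAt_of_frequently_mem ?_)
  refine Eventually.frequently ?_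
  filter_upwards [(hS.eventually_ray_mem hz hv).filter_mono (nhdsWithin_mono _ Ioi_subset_Ici_self)]
    with t ht using hS.subset ht

theorem IsRelOpen.partialDeriv_eq_zero (hS : IsRelOpen S) (hz : z ∈ S)
    (hmax : ∀ y ∈ S, f y ≤ f z) {i : Fin n} (hi : 0 < z 0 ∨ i ≠ 0) :
    partialDeriv i f z = 0 := by
  have h1 := hS.sum_partialDeriv_nonpos hz hmax (v := EuclideanSpace.single i 1)
    (hi.imp_right fun h => by simp [h.symm])
  have h2 := hS.sum_partialDeriv_nonpos hz hmax (v := -EuclideanSpace.single i 1)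
    (hi.imp_right fun h => by simp [h.symm])
  simp at h1 h2
  linarith

theorem IsRelOpen.partialDeriv_zero_nonpos (hS : IsRelOpen S) (hz : z ∈ S)
    (hmax : ∀ y ∈ S, f y ≤ f z) : partialDeriv 0 f z ≤ 0 := by
  simpa [Pi.single_apply] using hS.sum_partialDeriv_nonpos hz hmax
    (v := EuclideanSpace.single 0 1) (Or.inr (by simp))

theorem IsRelOpen.hasDerivWithinAt_ray (hS : IsRelOpen S) (hf : ContDiffOn ℝ ∞ f S)
    {v : EuclideanSpace ℝ (Fin n)} {ε t : ℝ} (hε : ∀ s ∈ Ico 0 ε, z + s • v ∈ S)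
    (ht : t ∈ Ico 0 ε) :
    HasDerivWithinAt (fun s : ℝ => f (z + s • v)) (∑ i, v i * partialDeriv i f (z + t • v))
      (Ico 0 ε) t := by
  rw [← fderivWithin_eq_sum_partialDeriv]
  have h1 := (hS.differentiableWithinAt hf (hε t ht)).hasFDerivWithinAt
  have h2 : HasDerivWithinAt (fun s : ℝ => z + s • v) v (Ico 0 ε) t := by
    simpa using (((hasDerivAt_id t).smul_const v).const_add z).hasDerivWithinAt
  exact h1.comp_hasDerivWithinAt t h2 fun s hs => hS.subset (hε s hs)

theorem IsRelOpen.sum_partialDeriv_partialDeriv_nonpos_of_le (hS : IsRelOpen S)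
    (hf : ContDiffOn ℝ ∞ f S) (hz : z ∈ S) (hmax : ∀ y ∈ S, f y ≤ f z)
    (hcrit : ∀ i, partialDeriv i f z = 0) {v : EuclideanSpace ℝ (Fin n)} (hv : 0 ≤ v 0) :
    ∑ i, ∑ j, v i * v j * partialDeriv i (partialDeriv j f) z ≤ 0 := by
  by_contra! hpos
  have hray := hS.eventually_ray_mem hz (Or.inr hv)
  obtain ⟨ε, hε0, hε⟩ : ∃ ε > 0, ∀ s ∈ Ico (0 : ℝ) ε, z + s • v ∈ S := by
    obtain ⟨ε, hε, h⟩ := mem_nhdsGE_iff_exists_Ico_subset.1 hray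
    exact ⟨ε, hε, fun s hs => h hs⟩
  have h0 : (0 : ℝ) ∈ Ico 0 ε := ⟨le_rfl, hε0⟩
  set φ : ℝ → ℝ := fun s => ∑ j, v j * partialDeriv j f (z + s • v) with hφ
  have hderiv : HasDerivWithinAt φ
      (∑ i, ∑ j, v i * v j * partialDeriv i (partialDeriv j f) z) (Ico 0 ε) 0 := by
    have hj : ∀ j ∈ Finset.univ, HasDerivWithinAt
        (fun s : ℝ => v j * partialDeriv j f (z + s • v))
        (v j * ∑ i, v i * partialDeriv i (partialDeriv j f) (z + (0 : ℝ) • v)) (Ico 0 ε) 0 :=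
      fun j _ => (hS.hasDerivWithinAt_ray (hS.contDiffOn_partialDeriv hf j) hε h0).const_mul _
    refine (HasDerivWithinAt.fun_sum hj).congr_deriv ?_
    rw [Finset.sum_comm]
    simp only [Finset.mul_sum, zero_smul, add_zero]
    refine Finset.sum_congr rfl fun j _ => Finset.sum_congr rfl fun i _ => by ring
  have hφ0 : φ 0 = 0 := by simp [hφ, hcrit]
  have hev : ∀ᶠ s in 𝓝[>] (0 : ℝ), 0 < φ s := by
    have hd : HasDerivWithinAt φ
      (∑ i, ∑ j, v i * v j * partialDeriv i (partialDeriv j f) z) (Ioi 0) 0 :=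
      hderiv.mono_of_mem_nhdsWithin (mem_of_superset (Ioo_mem_nhdsGT hε0) Ioo_subset_Ico_self)
    have ht := (hasDerivWithinAt_iff_tendsto_slope' (by simp)).1 hd
    filter_upwards [ht.eventually (lt_mem_nhds hpos), self_mem_nhdsWithin] with s hs hs0
    have hs0 : 0 < s := hs0
    rw [slope_def_field, hφ0, sub_zero, sub_zero] at hs
    exact (div_pos_iff_of_pos_right hs0).1 hs
  obtain ⟨δ, hδ0, hδ⟩ := mem_nhdsGT_iff_exists_Ioo_subset.1
    (inter_mem hev (Ioo_mem_nhdsGT hε0))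
  have hδ0 : 0 < δ := hδ0
  have hsub : Icc 0 (δ / 2) ⊆ Ico 0 ε := by
    intro s hs
    refine ⟨hs.1, ?_⟩
    rcases hs.1.eq_or_lt with h | h
    · rw [← h]; exact hε0
    · exact (hδ ⟨h, by linarith [hs.2]⟩).2.2
  have hmono : StrictMonoOn (fun s : ℝ => f (z + s • v)) (Icc 0 (δ / 2)) := by
    refine strictMonoOn_of_hasDerivWithinAt_pos (f' := φ) (convex_Icc _ _) ?_ ?_ ?_
    · exact fun s hs => ((hS.hasDerivWithinAt_ray hf hε (hsub hs)).mono hsub).continuousWithinAt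
    · intro s hs
      exact (hS.hasDerivWithinAt_ray hf hε (hsub (interior_subset hs))).mono
        (interior_subset.trans hsub)
    · intro s hs
      rw [interior_Icc] at hs
      exact (hδ ⟨hs.1, by linarith [hs.2]⟩).1
  have hlt := hmono ⟨le_rfl, by linarith⟩ ⟨by linarith, le_rfl⟩ (show (0 : ℝ) < δ / 2 by linarith)
  have hle := hmax _ (hε (δ / 2) (hsub ⟨by linarith, le_rfl⟩))
  simp only [zero_smul, add_zero] at hlt
  linarith

theorem IsRelOpen.sum_partialDeriv_partialDeriv_nonpos (hS : IsRelOpen S)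
    (hf : ContDiffOn ℝ ∞ f S) (hz : z ∈ S) (hmax : ∀ y ∈ S, f y ≤ f z)
    (hcrit : ∀ i, partialDeriv i f z = 0) (v : Fin n → ℝ) :
    ∑ i, ∑ j, v i * v j * partialDeriv i (partialDeriv j f) z ≤ 0 := by
  rcases le_total 0 (v 0) with h | h
  · exact hS.sum_partialDeriv_partialDeriv_nonpos_of_le hf hz hmax hcrit
      (v := WithLp.toLp 2 v) h
  · simpa using hS.sum_partialDeriv_partialDeriv_nonpos_of_le hf hz hmax hcrit
      (v := WithLp.toLp 2 (-v)) (by simpa using h)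

end HalfSpaceCalculus

section Algebra

open Matrix

variable {ι : Type*} [Fintype ι] [DecidableEq ι]

open scoped MatrixOrder in
theorem trace_mul_nonneg_of_posSemidef {A P : Matrix ι ι ℝ} (hA : A.PosSemidef)
    (hP : P.PosSemidef) : 0 ≤ (P * A).trace := by
  obtain ⟨B, rfl⟩ : ∃ B : Matrix ι ι ℝ, A = Bᴴ * B := by
    exact CStarAlgebra.nonneg_iff_eq_star_mul_self.1 hA.nonneg
  rw [← Matrix.mul_assoc, Matrix.trace_mul_comm, ← Matrix.mul_assoc]
  exact (hP.mul_mul_conjTranspose_same B).trace_nonneg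

theorem sum_mul_nonpos_of_posDef {A P : Matrix ι ι ℝ} (hA : A.PosDef)
    (hP : ∀ i j, P i j = P j i) (hv : ∀ v : ι → ℝ, ∑ i, ∑ j, v i * v j * P i j ≤ 0) :
    ∑ i, ∑ j, A i j * P i j ≤ 0 := by
  have hN : (-P).PosSemidef := by
    refine Matrix.PosSemidef.of_dotProduct_mulVec_nonneg ?_ fun v => ?_
    · ext i j
      simp [hP i j]
    · have := hv v
      have h2 : star v ⬝ᵥ (-P *ᵥ v) = -∑ i, ∑ j, v i * v j * P i j := by
        simp only [dotProduct, mulVec, Matrix.neg_apply, Finset.mul_sum, star_trivial,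
          ← Finset.sum_neg_distrib]
        exact Finset.sum_congr rfl fun i _ => Finset.sum_congr rfl fun j _ => by ring
      rw [h2]
      linarith
  have h := trace_mul_nonneg_of_posSemidef hA.posSemidef hN
  have h2 : ((-P) * A).trace = -∑ i, ∑ j, A i j * P i j := by
    simp only [Matrix.trace, Matrix.diag, Matrix.mul_apply, Matrix.neg_apply,
      ← Finset.sum_neg_distrib]
    rw [Finset.sum_comm]
    exact Finset.sum_congr rfl fun i _ => Finset.sum_congr rfl fun j _ => by
      rw [hP j i]; ring
  linarith

/-- The trace of the square of a `G`-self-adjoint endomorphism is nonnegative. -/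
theorem trace_sq_nonneg_of_selfAdjoint {G W : Matrix ι ι ℝ} (hG : G.PosDef)
    (hW : (W * G)ᵀ = W * G) : 0 ≤ (W * W).trace := by
  have hdet : IsUnit G.det := hG.det_pos.ne'.isUnit
  have h1 : W = (W * G) * G⁻¹ := by rw [Matrix.mul_assoc, Matrix.mul_nonsing_inv _ hdet, mul_one]
  have h2 : ((W * G) * G⁻¹ * (W * G)ᴴ).PosSemidef :=
    hG.inv.posSemidef.mul_mul_conjTranspose_same _
  have h3 := trace_mul_nonneg_of_posSemidef hG.inv.posSemidef h2
  rw [Matrix.conjTranspose_eq_transpose_of_trivial, hW, ← h1, Matrix.mul_assoc, ← h1] at h3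
  exact h3

/-- A `G`-self-adjoint endomorphism with eigenvalue `μ` has squared norm at least `μ²`. -/
theorem sq_le_trace_sq_of_eigenvector {G W : Matrix ι ι ℝ} (hG : G.PosDef)
    (hW : (W * G)ᵀ = W * G) {V : ι → ℝ} (hV : V ≠ 0) {μ : ℝ} (hμ : V ᵥ* W = μ • V) :
    μ ^ 2 ≤ (W * W).trace := by
  set F : ι → ℝ := G *ᵥ V with hF
  set q : ℝ := V ⬝ᵥ F with hq
  have hq0 : 0 < q := by simpa using hG.dotProduct_mulVec_pos hV
  have hsymm : Gᵀ = G := by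
    simpa [Matrix.conjTranspose_eq_transpose_of_trivial] using hG.isHermitian.eq
  have hVG : V ᵥ* G = F := by rw [hF, ← Matrix.vecMul_transpose, hsymm]
  have hWF : W *ᵥ F = μ • F := by
    rw [hF, Matrix.mulVec_mulVec, ← hW, Matrix.mulVec_transpose, ← Matrix.vecMul_vecMul, hμ,
      Matrix.smul_vecMul, hVG]
  have hadj : ((W - (μ / q) • vecMulVec F V) * G)ᵀ = (W - (μ / q) • vecMulVec F V) * G := by
    rw [Matrix.sub_mul, Matrix.smul_mul, Matrix.vecMulVec_mul, hVG, Matrix.transpose_sub, hW,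
      Matrix.transpose_smul, Matrix.transpose_vecMulVec]
  have h := trace_sq_nonneg_of_selfAdjoint hG hadj
  have hFV : F ⬝ᵥ V = q := dotProduct_comm _ _
  have e1 : (W * vecMulVec F V).trace = μ * q := by
    rw [Matrix.mul_vecMulVec, Matrix.trace_vecMulVec, hWF, smul_dotProduct, hFV, smul_eq_mul]
  have e2 : (vecMulVec F V * W).trace = μ * q := by
    rw [Matrix.trace_mul_comm, e1]
  have e3 : (vecMulVec F V * vecMulVec F V).trace = q * q := by
    rw [Matrix.vecMulVec_mul_vecMulVec, Matrix.trace_vecMulVec, dotProduct_smul, smul_eq_mul, hFV, ← hq]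
  rw [Matrix.sub_mul, Matrix.mul_sub, Matrix.mul_sub, Matrix.trace_sub, Matrix.trace_sub,
    Matrix.trace_sub] at h
  simp only [Matrix.smul_mul, Matrix.mul_smul, Matrix.trace_smul, smul_eq_mul, e1, e2, e3] at h
  have hne := hq0.ne'
  have : (W * W).trace - μ / q * (μ * q) - (μ / q * (μ * q) - μ / q * (μ / q * (q * q)))
    = (W * W).trace - μ ^ 2 := by field_simp; ring
  linarith

theorem contDiffOn_det {E : Type*} [NormedAddCommGroup E] [NormedSpace ℝ E] {S : Set E}
    {A : E → Matrix ι ι ℝ} (hA : ∀ i j, ContDiffOn ℝ ∞ (fun z => A z i j) S) :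
    ContDiffOn ℝ ∞ (fun z => (A z).det) S := by
  simp only [Matrix.det_apply']
  exact ContDiffOn.sum fun σ _ => contDiffOn_const.mul (contDiffOn_prod fun i _ => hA _ _)

end Algebra

section LocalMetric

variable {n : ℕ} [NeZero n]

/-- `G` is the matrix of a smooth Riemannian metric on the relatively open subset `S` of the
half-space. -/
structure IsLocalMetric (S : Set (EuclideanSpace ℝ (Fin n)))
    (G : EuclideanSpace ℝ (Fin n) → Matrix (Fin n) (Fin n) ℝ) : Prop where
  relOpen : IsRelOpen S
  contDiffOn : ∀ i j, ContDiffOn ℝ ∞ (fun z => G z i j) S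
  posDef : ∀ z ∈ S, (G z).PosDef

/-- The components `∑_l g^{kl} ∂_l f` of the gradient of `f`. -/
def gradCoord (G : EuclideanSpace ℝ (Fin n) → Matrix (Fin n) (Fin n) ℝ)
    (f : EuclideanSpace ℝ (Fin n) → ℝ) (k : Fin n) (z : EuclideanSpace ℝ (Fin n)) : ℝ :=
  ∑ l, (G z)⁻¹ k l * partialDeriv l f z

/-- The components `∂_i V^k + ∑_l Γ^k_{il} V^l` of the covariant derivative of `V`. -/
def covDeriv (G : EuclideanSpace ℝ (Fin n) → Matrix (Fin n) (Fin n) ℝ)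
    (V : Fin n → EuclideanSpace ℝ (Fin n) → ℝ) (i k : Fin n) (z : EuclideanSpace ℝ (Fin n)) : ℝ :=
  partialDeriv i (V k) z + ∑ l, christoffel G k i l z * V l z

/-- The squared norm `∑_{k,l} g^{kl} ∂_k f ∂_l f` of the gradient of `f`. -/
def gradNormSqCoord (G : EuclideanSpace ℝ (Fin n) → Matrix (Fin n) (Fin n) ℝ)
    (f : EuclideanSpace ℝ (Fin n) → ℝ) (z : EuclideanSpace ℝ (Fin n)) : ℝ :=
  ∑ k, gradCoord G f k z * partialDeriv k f z

variable {S : Set (EuclideanSpace ℝ (Fin n))}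
  {G : EuclideanSpace ℝ (Fin n) → Matrix (Fin n) (Fin n) ℝ}
  {f : EuclideanSpace ℝ (Fin n) → ℝ} {z : EuclideanSpace ℝ (Fin n)}
  {V : Fin n → EuclideanSpace ℝ (Fin n) → ℝ}

namespace IsLocalMetric

theorem symm (hG : IsLocalMetric S G) (hz : z ∈ S) (i j : Fin n) : G z i j = G z j i := by
  simpa using (hG.posDef z hz).isHermitian.apply j i

theorem inv_symm (hG : IsLocalMetric S G) (hz : z ∈ S) (i j : Fin n) :
    (G z)⁻¹ i j = (G z)⁻¹ j i := by
  simpa using (hG.posDef z hz).inv.isHermitian.apply j i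

theorem isUnit_det (hG : IsLocalMetric S G) (hz : z ∈ S) : IsUnit (G z).det :=
  (hG.posDef z hz).det_pos.ne'.isUnit

theorem sum_mul_inv (hG : IsLocalMetric S G) (hz : z ∈ S) (i k : Fin n) :
    ∑ j, G z i j * (G z)⁻¹ j k = if i = k then 1 else 0 := by
  rw [← Matrix.mul_apply, Matrix.mul_nonsing_inv _ (hG.isUnit_det hz), Matrix.one_apply]

theorem sum_inv_mul (hG : IsLocalMetric S G) (hz : z ∈ S) (i k : Fin n) :
    ∑ j, (G z)⁻¹ i j * G z j k = if i = k then 1 else 0 := by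
  rw [← Matrix.mul_apply, Matrix.nonsing_inv_mul _ (hG.isUnit_det hz), Matrix.one_apply]

theorem inv_zero_zero_pos (hG : IsLocalMetric S G) (hz : z ∈ S) : 0 < (G z)⁻¹ 0 0 :=
  (hG.posDef z hz).inv.diag_pos

theorem contDiffOn_inv (hG : IsLocalMetric S G) (i j : Fin n) :
    ContDiffOn ℝ ∞ (fun z => (G z)⁻¹ i j) S := by
  have h : ContDiffOn ℝ ∞ (fun z => ((G z).det)⁻¹ * (G z).adjugate i j) S := by
    refine ((contDiffOn_det hG.contDiffOn).inv fun z hz => (hG.isUnit_det hz).ne_zero).mul ?_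
    simp only [Matrix.adjugate_apply]
    refine contDiffOn_det fun k l => ?_
    by_cases hk : k = j
    · subst hk
      simpa using contDiffOn_const
    · simpa [Matrix.updateRow_ne hk] using hG.contDiffOn k l
  refine h.congr fun z _ => ?_
  simp [Matrix.inv_def]

theorem contDiffOn_christoffel (hG : IsLocalMetric S G) (k i j : Fin n) :
    ContDiffOn ℝ ∞ (christoffel G k i j) S :=
  contDiffOn_const.mul <| ContDiffOn.sum fun l _ => (hG.contDiffOn_inv k l).mul <|
    ((hG.relOpen.contDiffOn_partialDeriv (hG.contDiffOn j l) i).add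
      (hG.relOpen.contDiffOn_partialDeriv (hG.contDiffOn i l) j)).sub
      (hG.relOpen.contDiffOn_partialDeriv (hG.contDiffOn i j) l)

theorem contDiffOn_gradCoord (hG : IsLocalMetric S G) (hf : ContDiffOn ℝ ∞ f S) (k : Fin n) :
    ContDiffOn ℝ ∞ (gradCoord G f k) S :=
  ContDiffOn.sum fun l _ => (hG.contDiffOn_inv k l).mul (hG.relOpen.contDiffOn_partialDeriv hf l)

theorem contDiffOn_gradNormSqCoord (hG : IsLocalMetric S G) (hf : ContDiffOn ℝ ∞ f S) :
    ContDiffOn ℝ ∞ (gradNormSqCoord G f) S :=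
  ContDiffOn.sum fun k _ => (hG.contDiffOn_gradCoord hf k).mul
    (hG.relOpen.contDiffOn_partialDeriv hf k)

theorem contDiffOn_covDeriv (hG : IsLocalMetric S G) (hV : ∀ k, ContDiffOn ℝ ∞ (V k) S)
    (i k : Fin n) : ContDiffOn ℝ ∞ (covDeriv G V i k) S :=
  (hG.relOpen.contDiffOn_partialDeriv (hV k) i).add <|
    ContDiffOn.sum fun l _ => (hG.contDiffOn_christoffel k i l).mul (hV l)

theorem partialDeriv_symm (hG : IsLocalMetric S G) (hz : z ∈ S) (l i j : Fin n) :
    partialDeriv l (fun y => G y i j) z = partialDeriv l (fun y => G y j i) z :=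
  hG.relOpen.partialDeriv_congr (fun _ hy => hG.symm hy i j) hz l

theorem christoffel_symm (hG : IsLocalMetric S G) (hz : z ∈ S) (k i j : Fin n) :
    christoffel G k i j z = christoffel G k j i z := by
  unfold christoffel
  simp only [hG.partialDeriv_symm hz _ i j]
  congr 1
  exact Finset.sum_congr rfl fun l _ => by ring

theorem sum_christoffel_mul (hG : IsLocalMetric S G) (hz : z ∈ S) (i j k : Fin n) :
    ∑ p, christoffel G p i j z * G z p k
      = (1 / 2) * (partialDeriv i (fun y => G y j k) z + partialDeriv j (fun y => G y i k) z
        - partialDeriv k (fun y => G y i j) z) := by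
  simp only [christoffel, mul_assoc, Finset.sum_mul, ← Finset.mul_sum]
  congr 1
  rw [Finset.sum_comm]
  have h : ∀ l, ∑ p, (G z)⁻¹ p l * ((partialDeriv i (fun y => G y j l) z
      + partialDeriv j (fun y => G y i l) z - partialDeriv l (fun y => G y i j) z) * G z p k)
      = (if l = k then 1 else 0) * (partialDeriv i (fun y => G y j l) z
      + partialDeriv j (fun y => G y i l) z - partialDeriv l (fun y => G y i j) z) := by
    intro l
    rw [← hG.sum_inv_mul hz l k, Finset.sum_mul]
    exact Finset.sum_congr rfl fun p _ => by rw [hG.inv_symm hz p l]; ring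
  simp [h]

theorem partialDeriv_metric (hG : IsLocalMetric S G) (hz : z ∈ S) (k i j : Fin n) :
    partialDeriv k (fun y => G y i j) z
      = ∑ p, christoffel G p k i z * G z p j + ∑ p, christoffel G p k j z * G z p i := by
  rw [hG.sum_christoffel_mul hz, hG.sum_christoffel_mul hz, hG.partialDeriv_symm hz k j i,
    hG.partialDeriv_symm hz i k j]
  ring

theorem sum_gradCoord_mul (hG : IsLocalMetric S G) (hz : z ∈ S) (j : Fin n) :
    ∑ k, gradCoord G f k z * G z k j = partialDeriv j f z := by
  simp only [gradCoord, Finset.sum_mul]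
  rw [Finset.sum_comm]
  have h : ∀ l, ∑ k, (G z)⁻¹ k l * partialDeriv l f z * G z k j
      = (if l = j then 1 else 0) * partialDeriv l f z := by
    intro l
    rw [← hG.sum_inv_mul hz l j, Finset.sum_mul]
    exact Finset.sum_congr rfl fun p _ => by rw [hG.inv_symm hz p l]; ring
  simp [h]

theorem partialDeriv_partialDeriv_eq (hG : IsLocalMetric S G) (hf : ContDiffOn ℝ ∞ f S)
    (hz : z ∈ S) (i j : Fin n) :
    partialDeriv i (partialDeriv j f) z
      = ∑ k, (partialDeriv i (gradCoord G f k) z * G z k j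
        + gradCoord G f k z * partialDeriv i (fun y => G y k j) z) := by
  have hc := hG.contDiffOn_gradCoord hf
  rw [← hG.relOpen.partialDeriv_congr (fun y hy => hG.sum_gradCoord_mul (f := f) hy j) hz i,
    hG.relOpen.partialDeriv_sum (fun k => (hc k).mul (hG.contDiffOn k j)) hz]
  exact Finset.sum_congr rfl fun k _ => hG.relOpen.partialDeriv_mul (hc k) (hG.contDiffOn k j) hz i

/-- The Hessian is the covariant derivative of the gradient. -/
theorem hessianCoord_eq (hG : IsLocalMetric S G) (hf : ContDiffOn ℝ ∞ f S)
    (hz : z ∈ S) (i j : Fin n) :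
    hessianCoord G f i j z = ∑ k, covDeriv G (gradCoord G f) i k z * G z k j := by
  rw [hessianCoord, hG.partialDeriv_partialDeriv_eq hf hz]
  simp only [hG.partialDeriv_metric hz, covDeriv, add_mul, mul_add, Finset.sum_add_distrib,
    Finset.mul_sum, Finset.sum_mul, ← hG.sum_gradCoord_mul (f := f) hz]
  have e1 : ∑ k, ∑ p, gradCoord G f k z * (christoffel G p i k z * G z p j)
      = ∑ k, ∑ l, christoffel G k i l z * gradCoord G f l z * G z k j := by
    rw [Finset.sum_comm]
    exact Finset.sum_congr rfl fun _ _ => Finset.sum_congr rfl fun _ _ => by ring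
  have e2 : ∑ k, ∑ p, gradCoord G f k z * (christoffel G p i j z * G z p k)
      = ∑ k, ∑ p, christoffel G k i j z * (gradCoord G f p z * G z p k) := by
    rw [Finset.sum_comm]
    exact Finset.sum_congr rfl fun p _ => Finset.sum_congr rfl fun k _ => by
      rw [hG.symm hz p k]; ring
  rw [e1, e2]
  ring

theorem hessianCoord_symm (hG : IsLocalMetric S G) (hf : ContDiffOn ℝ ∞ f S)
    (hz : z ∈ S) (i j : Fin n) : hessianCoord G f i j z = hessianCoord G f j i z := by
  simp only [hessianCoord, hG.relOpen.partialDeriv_comm hf hz i j, hG.christoffel_symm hz _ i j]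

/-- The Laplacian is the divergence of the gradient. -/
theorem laplacianCoord_eq (hG : IsLocalMetric S G) (hf : ContDiffOn ℝ ∞ f S) (hz : z ∈ S) :
    laplacianCoord G f z = ∑ i, covDeriv G (gradCoord G f) i i z := by
  unfold laplacianCoord
  refine Finset.sum_congr rfl fun i _ => ?_
  simp only [hG.hessianCoord_eq hf hz, Finset.mul_sum]
  rw [Finset.sum_comm]
  have h : ∀ k, ∑ j, (G z)⁻¹ i j * (covDeriv G (gradCoord G f) i k z * G z k j)
      = covDeriv G (gradCoord G f) i k z * if i = k then 1 else 0 := by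
    intro k
    rw [← hG.sum_inv_mul hz i k, Finset.mul_sum]
    exact Finset.sum_congr rfl fun j _ => by rw [hG.symm hz k j]; ring
  simp [h]

theorem partialDeriv_gradNormSqCoord (hG : IsLocalMetric S G) (hf : ContDiffOn ℝ ∞ f S)
    (hz : z ∈ S) (i : Fin n) :
    partialDeriv i (gradNormSqCoord G f) z
      = 2 * ∑ k, hessianCoord G f i k z * gradCoord G f k z := by
  have hc := hG.contDiffOn_gradCoord hf
  have hd := hG.relOpen.contDiffOn_partialDeriv hf
  have h1 : partialDeriv i (gradNormSqCoord G f) z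
      = ∑ k, (partialDeriv i (gradCoord G f k) z * partialDeriv k f z
        + gradCoord G f k z * partialDeriv i (partialDeriv k f) z) := by
    unfold gradNormSqCoord
    rw [hG.relOpen.partialDeriv_sum (fun k => (hc k).mul (hd k)) hz]
    exact Finset.sum_congr rfl fun k _ => hG.relOpen.partialDeriv_mul (hc k) (hd k) hz i
  have h2 : ∑ k, partialDeriv i (gradCoord G f k) z * partialDeriv k f z
      = ∑ k, hessianCoord G f i k z * gradCoord G f k z
        - ∑ k, ∑ l, christoffel G k i l z * gradCoord G f l z * partialDeriv k f z := by
    rw [eq_sub_iff_add_eq, ← Finset.sum_add_distrib]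
    simp only [← Finset.sum_mul, ← add_mul]
    change ∑ k, covDeriv G (gradCoord G f) i k z * partialDeriv k f z = _
    simp only [← hG.sum_gradCoord_mul (f := f) hz, hG.hessianCoord_eq hf hz, Finset.mul_sum,
      Finset.sum_mul]
    rw [Finset.sum_comm]
    exact Finset.sum_congr rfl fun p _ => Finset.sum_congr rfl fun k _ => by
      rw [hG.symm hz p k]; ring
  have h3 : ∑ k, gradCoord G f k z * partialDeriv i (partialDeriv k f) z
      = ∑ k, hessianCoord G f i k z * gradCoord G f k z
        + ∑ k, ∑ l, christoffel G k i l z * gradCoord G f l z * partialDeriv k f z := by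
    have e : ∑ k, ∑ l, christoffel G k i l z * gradCoord G f l z * partialDeriv k f z
        = ∑ k, ∑ p, christoffel G p i k z * gradCoord G f k z * partialDeriv p f z :=
      Finset.sum_comm
    rw [e, ← Finset.sum_add_distrib]
    refine Finset.sum_congr rfl fun k _ => ?_
    rw [hessianCoord, sub_mul, Finset.sum_mul]
    have e2 : ∑ p, christoffel G p i k z * partialDeriv p f z * gradCoord G f k z
        = ∑ p, christoffel G p i k z * gradCoord G f k z * partialDeriv p f z :=
      Finset.sum_congr rfl fun p _ => by ring
    rw [e2]
    ring
  rw [h1, Finset.sum_add_distrib, h2, h3]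
  ring

theorem sum_inv_mul_hessianCoord_mul (hG : IsLocalMetric S G) (hf : ContDiffOn ℝ ∞ f S)
    (hz : z ∈ S) (j : Fin n) :
    ∑ i, (G z)⁻¹ j i * ∑ k, hessianCoord G f i k z * gradCoord G f k z
      = ∑ k, covDeriv G (gradCoord G f) k j z * gradCoord G f k z := by
  simp only [Finset.mul_sum]
  rw [Finset.sum_comm]
  refine Finset.sum_congr rfl fun k _ => ?_
  have h : ∀ p, ∑ i, (G z)⁻¹ j i * G z p i = if j = p then 1 else 0 := fun p => by
    rw [← hG.sum_inv_mul hz j p]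
    exact Finset.sum_congr rfl fun i _ => by rw [hG.symm hz p i]
  have e : ∑ i, (G z)⁻¹ j i * (hessianCoord G f i k z * gradCoord G f k z)
      = ∑ p, covDeriv G (gradCoord G f) k p z * gradCoord G f k z
        * ∑ i, (G z)⁻¹ j i * G z p i := by
    simp only [Finset.mul_sum]
    rw [Finset.sum_comm]
    refine Finset.sum_congr rfl fun i _ => ?_
    rw [hG.hessianCoord_symm hf hz, hG.hessianCoord_eq hf hz, Finset.sum_mul, Finset.mul_sum]
    exact Finset.sum_congr rfl fun p _ => by ring
  rw [e]
  simp [h]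

/-- The Ricci identity: the commutator of covariant derivatives of a vector field, contracted. -/
theorem ricci_identity (hG : IsLocalMetric S G) (hV : ∀ k, ContDiffOn ℝ ∞ (V k) S)
    (hz : z ∈ S) (k : Fin n) :
    ∑ i, partialDeriv i (covDeriv G V k i) z
      = partialDeriv k (fun y => ∑ i, covDeriv G V i i y) z
        + ∑ l, ricciCoord G k l z * V l z
        - ∑ i, ∑ p, christoffel G i i p z * covDeriv G V k p z
        + ∑ i, ∑ p, christoffel G p k i z * covDeriv G V p i z := by
  have hR := hG.relOpen
  have hΓ := hG.contDiffOn_christoffel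
  have hD : ∀ a b c : Fin n, partialDeriv a (covDeriv G V b c) z
      = partialDeriv a (partialDeriv b (V c)) z
        + ∑ l, (partialDeriv a (christoffel G c b l) z * V l z
          + christoffel G c b l z * partialDeriv a (V l) z) := by
    intro a b c
    unfold covDeriv
    rw [hR.partialDeriv_add (hR.contDiffOn_partialDeriv (hV c) b)
      (ContDiffOn.sum fun l _ => (hΓ c b l).mul (hV l)) hz,
      hR.partialDeriv_sum (fun l => (hΓ c b l).mul (hV l)) hz]
    congr 1
    exact Finset.sum_congr rfl fun l _ => hR.partialDeriv_mul (hΓ c b l) (hV l) hz a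
  rw [hR.partialDeriv_sum (fun i => hG.contDiffOn_covDeriv hV i i) hz]
  simp only [hD, hR.partialDeriv_comm (hV _) hz k]
  simp only [covDeriv, ricciCoord, mul_add, add_mul, sub_mul, Finset.sum_add_distrib,
    Finset.mul_sum, Finset.sum_mul, Finset.sum_sub_distrib]
  have e1 : ∑ i, ∑ p, christoffel G p k i z * partialDeriv p (V i) z
      = ∑ i, ∑ l, christoffel G i k l z * partialDeriv i (V l) z := Finset.sum_comm
  have e2 : ∑ l, ∑ i, partialDeriv i (christoffel G i k l) z * V l z
      = ∑ i, ∑ l, partialDeriv i (christoffel G i k l) z * V l z := Finset.sum_comm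
  have e3 : ∑ l, ∑ i, partialDeriv k (christoffel G i i l) z * V l z
      = ∑ i, ∑ l, partialDeriv k (christoffel G i i l) z * V l z := Finset.sum_comm
  have e4 : ∑ l, ∑ i, ∑ p, christoffel G i i p z * christoffel G p k l z * V l z
      = ∑ i, ∑ p, ∑ l, christoffel G i i p z * (christoffel G p k l z * V l z) := by
    rw [Finset.sum_comm]
    refine Finset.sum_congr rfl fun i _ => ?_
    rw [Finset.sum_comm]
    exact Finset.sum_congr rfl fun p _ => Finset.sum_congr rfl fun l _ => by ring
  have e5 : ∑ l, ∑ i, ∑ p, christoffel G i k p z * christoffel G p i l z * V l z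
      = ∑ i, ∑ p, ∑ l, christoffel G p k i z * (christoffel G i p l z * V l z) := by
    rw [Finset.sum_comm]
    conv_rhs => rw [Finset.sum_comm]
    refine Finset.sum_congr rfl fun i _ => ?_
    rw [Finset.sum_comm]
    exact Finset.sum_congr rfl fun p _ => Finset.sum_congr rfl fun l _ => by ring
  rw [e1, e2, e3, e4, e5]
  ring

end IsLocalMetric

end LocalMetric

section MaximumPoint

variable {n : ℕ} [NeZero n] {S : Set (EuclideanSpace ℝ (Fin n))}
  {G : EuclideanSpace ℝ (Fin n) → Matrix (Fin n) (Fin n) ℝ}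
  {f : EuclideanSpace ℝ (Fin n) → ℝ} {z : EuclideanSpace ℝ (Fin n)} {c lam : ℝ}

/-- The test function `|∇f|² + c f²`. -/
def energy (G : EuclideanSpace ℝ (Fin n) → Matrix (Fin n) (Fin n) ℝ)
    (f : EuclideanSpace ℝ (Fin n) → ℝ) (c : ℝ) (z : EuclideanSpace ℝ (Fin n)) : ℝ :=
  gradNormSqCoord G f z + c * (f z * f z)

/-- The components `∇_{∇f}∇f + c f ∇f` of half the gradient of `|∇f|² + c f²`. -/
def halfGradEnergy (G : EuclideanSpace ℝ (Fin n) → Matrix (Fin n) (Fin n) ℝ)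
    (f : EuclideanSpace ℝ (Fin n) → ℝ) (c : ℝ) (j : Fin n) (z : EuclideanSpace ℝ (Fin n)) : ℝ :=
  ∑ k, covDeriv G (gradCoord G f) k j z * gradCoord G f k z + c * (f z * gradCoord G f j z)

/-- The function `1 / √g^{00}`. -/
def invSqrtInv (G : EuclideanSpace ℝ (Fin n) → Matrix (Fin n) (Fin n) ℝ)
    (z : EuclideanSpace ℝ (Fin n)) : ℝ :=
  (√((G z)⁻¹ 0 0))⁻¹

/-- A function vanishing on the boundary hyperplane has vanishing tangential derivatives there. -/
theorem IsRelOpen.partialDeriv_eq_zero_of_boundary (hS : IsRelOpen S) (hf : ContDiffOn ℝ ∞ f S)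
    (hz : z ∈ S) (hz0 : z 0 = 0) (hvan : ∀ y ∈ S, y 0 = 0 → f y = 0) {i : Fin n} (hi : i ≠ 0) :
    partialDeriv i f z = 0 := by
  set v : EuclideanSpace ℝ (Fin n) := EuclideanSpace.single i 1 with hv
  have hv0 : v 0 = 0 := by simp [hv, hi.symm]
  obtain ⟨ε, hε0, hε⟩ := mem_nhdsGE_iff_exists_Ico_subset.1
    (hS.eventually_ray_mem hz (v := v) (Or.inr hv0.ge))
  have hε0 : (0 : ℝ) < ε := hε0
  have h0 : (0 : ℝ) ∈ Ico 0 ε := ⟨le_rfl, hε0⟩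
  have h1 := hS.hasDerivWithinAt_ray hf (v := v) (z := z) (fun s hs => hε hs) h0
  have hval : ∀ s ∈ Ico 0 ε, f (z + s • v) = 0 := fun s hs =>
    hvan _ (hε hs) (by simp [hz0, hv0])
  have h2 : HasDerivWithinAt (fun s : ℝ => f (z + s • v)) 0 (Ico 0 ε) 0 :=
    (hasDerivWithinAt_const (0 : ℝ) (Ico 0 ε) (0 : ℝ)).congr hval (hval 0 h0)
  have h3 := (uniqueDiffOn_Ico (0 : ℝ) ε 0 h0).eq_deriv _ h1 h2
  simpa [hv] using h3

namespace IsLocalMetric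

theorem contDiffOn_energy (hG : IsLocalMetric S G) (hf : ContDiffOn ℝ ∞ f S) (c : ℝ) :
    ContDiffOn ℝ ∞ (energy G f c) S :=
  (hG.contDiffOn_gradNormSqCoord hf).add (contDiffOn_const.mul (hf.mul hf))

theorem partialDeriv_energy (hG : IsLocalMetric S G) (hf : ContDiffOn ℝ ∞ f S) (hz : z ∈ S)
    (i : Fin n) :
    partialDeriv i (energy G f c) z
      = 2 * ∑ k, hessianCoord G f i k z * gradCoord G f k z
        + 2 * (c * (f z * partialDeriv i f z)) := by
  unfold energy
  rw [hG.relOpen.partialDeriv_add (hG.contDiffOn_gradNormSqCoord hf)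
    (contDiffOn_const.mul (hf.mul hf)) hz, hG.partialDeriv_gradNormSqCoord hf hz,
    hG.relOpen.partialDeriv_const_mul c (hf.mul hf) hz, hG.relOpen.partialDeriv_mul hf hf hz]
  ring

theorem sum_inv_mul_partialDeriv_energy (hG : IsLocalMetric S G) (hf : ContDiffOn ℝ ∞ f S)
    (hz : z ∈ S) (j : Fin n) :
    ∑ i, (G z)⁻¹ j i * partialDeriv i (energy G f c) z = 2 * halfGradEnergy G f c j z := by
  simp only [hG.partialDeriv_energy hf hz, mul_add, Finset.sum_add_distrib]
  rw [halfGradEnergy, ← hG.sum_inv_mul_hessianCoord_mul hf hz]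
  simp only [gradCoord, mul_add, Finset.mul_sum]
  congr 1
  · exact Finset.sum_congr rfl fun i _ => Finset.sum_congr rfl fun k _ =>
      Finset.sum_congr rfl fun l _ => by ring
  · exact Finset.sum_congr rfl fun i _ => by ring

/-- If the normal component of the gradient of `|∇f|² + c f²` has the right sign at boundary
points, then a maximum point is critical. -/
theorem partialDeriv_energy_eq_zero (hG : IsLocalMetric S G) (hf : ContDiffOn ℝ ∞ f S)
    (hz : z ∈ S) (hmax : ∀ y ∈ S, energy G f c y ≤ energy G f c z)
    (hbdry : z 0 = 0 → 0 ≤ halfGradEnergy G f c 0 z) (i : Fin n) :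
    partialDeriv i (energy G f c) z = 0 := by
  have hz0 : z ∈ {y : EuclideanSpace ℝ (Fin n) | 0 ≤ y 0} :=
    range_halfSpace (n := n) ▸ hG.relOpen.subset hz
  rcases (show 0 ≤ z 0 from hz0).lt_or_eq with h | h
  · exact hG.relOpen.partialDeriv_eq_zero hz hmax (Or.inl h)
  by_cases hi : i = 0
  · subst hi
    refine le_antisymm (hG.relOpen.partialDeriv_zero_nonpos hz hmax) ?_
    have h1 := hG.sum_inv_mul_partialDeriv_energy (c := c) hf hz 0
    rw [Finset.sum_eq_single 0 (fun j _ hj => by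
      rw [hG.relOpen.partialDeriv_eq_zero hz hmax (Or.inr hj), mul_zero]) (by simp)] at h1
    have h2 := hbdry h.symm
    have h3 : 0 ≤ (G z)⁻¹ 0 0 * partialDeriv 0 (energy G f c) z := by rw [h1]; linarith
    exact nonneg_of_mul_nonneg_right h3 (hG.inv_zero_zero_pos hz)
  · exact hG.relOpen.partialDeriv_eq_zero hz hmax (Or.inr hi)

theorem contDiffOn_halfGradEnergy (hG : IsLocalMetric S G) (hf : ContDiffOn ℝ ∞ f S) (c : ℝ)
    (j : Fin n) : ContDiffOn ℝ ∞ (halfGradEnergy G f c j) S :=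
  (ContDiffOn.sum fun k _ => (hG.contDiffOn_covDeriv (hG.contDiffOn_gradCoord hf) k j).mul
    (hG.contDiffOn_gradCoord hf k)).add
    (contDiffOn_const.mul (hf.mul (hG.contDiffOn_gradCoord hf j)))

/-- The second derivative test at a maximum point of `|∇f|² + c f²`. -/
theorem sum_partialDeriv_halfGradEnergy_nonpos (hG : IsLocalMetric S G)
    (hf : ContDiffOn ℝ ∞ f S) (hz : z ∈ S)
    (hmax : ∀ y ∈ S, energy G f c y ≤ energy G f c z)
    (hcrit : ∀ i, partialDeriv i (energy G f c) z = 0) :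
    ∑ j, partialDeriv j (halfGradEnergy G f c j) z ≤ 0 := by
  have hE := hG.contDiffOn_energy hf c
  have hR := hG.relOpen
  have h1 : ∀ j, 2 * partialDeriv j (halfGradEnergy G f c j) z
      = ∑ i, (G z)⁻¹ j i * partialDeriv j (partialDeriv i (energy G f c)) z := by
    intro j
    rw [← hR.partialDeriv_const_mul 2 (hG.contDiffOn_halfGradEnergy hf c j) hz,
      ← hR.partialDeriv_congr (fun y hy => hG.sum_inv_mul_partialDeriv_energy hf hy j) hz,
      hR.partialDeriv_sum (fun i => (hG.contDiffOn_inv j i).mul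
        (hR.contDiffOn_partialDeriv hE i)) hz]
    refine Finset.sum_congr rfl fun i _ => ?_
    rw [hR.partialDeriv_mul (hG.contDiffOn_inv j i) (hR.contDiffOn_partialDeriv hE i) hz, hcrit]
    ring
  have h2 := sum_mul_nonpos_of_posDef (hG.posDef z hz).inv
    (P := Matrix.of fun j i => partialDeriv j (partialDeriv i (energy G f c)) z)
    (fun i j => hR.partialDeriv_comm hE hz i j)
    (fun v => hR.sum_partialDeriv_partialDeriv_nonpos hE hz hmax hcrit v)
  simp only [Matrix.of_apply, ← h1, ← Finset.mul_sum] at h2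
  linarith

/-- The Bochner formula for `½Δ(|∇f|² + c f²)`, as the divergence of the vector field
`∇_{∇f}∇f + c f ∇f`. -/
theorem sum_partialDeriv_halfGradEnergy (hG : IsLocalMetric S G)
    (hf : ContDiffOn ℝ ∞ f S) (hz : z ∈ S)
    (heig : ∀ y ∈ S, laplacianCoord G f y = -lam * f y) :
    ∑ j, partialDeriv j (halfGradEnergy G f c j) z
        + ∑ i, ∑ p, christoffel G i i p z * halfGradEnergy G f c p z
      = ∑ k, ∑ j, covDeriv G (gradCoord G f) k j z * covDeriv G (gradCoord G f) j k z
        + ∑ j, ∑ k, ricciCoord G j k z * gradCoord G f j z * gradCoord G f k z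
        + (c - lam) * gradNormSqCoord G f z - c * lam * f z ^ 2 := by
  have hR := hG.relOpen
  have hV := hG.contDiffOn_gradCoord hf
  have hW := hG.contDiffOn_covDeriv hV
  set V := gradCoord G f with hVdef
  set W := covDeriv G V with hWdef
  have hdiv : ∀ y ∈ S, ∑ i, W i i y = -lam * f y := fun y hy => by
    rw [← heig y hy, hG.laplacianCoord_eq hf hy]
  have hD : ∀ j, partialDeriv j (halfGradEnergy G f c j) z
      = ∑ k, (partialDeriv j (W k j) z * V k z + W k j z * partialDeriv j (V k) z)
        + c * (partialDeriv j f z * V j z + f z * partialDeriv j (V j) z) := by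
    intro j
    unfold halfGradEnergy
    rw [hR.partialDeriv_add (ContDiffOn.sum fun k _ => (hW k j).mul (hV k))
      (contDiffOn_const.mul (hf.mul (hV j))) hz,
      hR.partialDeriv_sum (fun k => (hW k j).mul (hV k)) hz,
      hR.partialDeriv_const_mul c (hf.mul (hV j)) hz, hR.partialDeriv_mul hf (hV j) hz]
    congr 1
    exact Finset.sum_congr rfl fun k _ => hR.partialDeriv_mul (hW k j) (hV k) hz j
  have hDV : ∀ j k, partialDeriv j (V k) z = W j k z - ∑ l, christoffel G k j l z * V l z :=
    fun j k => by simp [hWdef, covDeriv]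
  have hRic : ∀ k, ∑ j, partialDeriv j (W k j) z
      = -lam * partialDeriv k f z + ∑ l, ricciCoord G k l z * V l z
        - ∑ i, ∑ p, christoffel G i i p z * W k p z
        + ∑ i, ∑ p, christoffel G p k i z * W p i z := by
    intro k
    rw [hG.ricci_identity hV hz k, hR.partialDeriv_congr hdiv hz k,
      hR.partialDeriv_const_mul _ hf hz]
  have e1 : ∑ j, ∑ k, partialDeriv j (W k j) z * V k z
      = ∑ k, (-lam * partialDeriv k f z + ∑ l, ricciCoord G k l z * V l z
        - ∑ i, ∑ p, christoffel G i i p z * W k p z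
        + ∑ i, ∑ p, christoffel G p k i z * W p i z) * V k z := by
    rw [Finset.sum_comm]
    exact Finset.sum_congr rfl fun k _ => by rw [← hRic k, Finset.sum_mul]
  have e2 : ∑ j, partialDeriv j (V j) z
      = -lam * f z - ∑ j, ∑ l, christoffel G j j l z * V l z := by
    simp only [hDV, Finset.sum_sub_distrib, hdiv z hz]
  have e3 : ∑ j, ∑ k, W k j z * partialDeriv j (V k) z
      = ∑ k, ∑ j, W k j z * W j k z
        - ∑ k, ∑ i, ∑ p, christoffel G p k i z * W p i z * V k z := by
    simp only [hDV, mul_sub, Finset.sum_sub_distrib, Finset.mul_sum]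
    congr 1
    · exact Finset.sum_comm
    · conv_rhs => rw [Finset.sum_comm]
      refine Finset.sum_congr rfl fun j _ => ?_
      rw [Finset.sum_comm]
      refine Finset.sum_congr rfl fun l _ => Finset.sum_congr rfl fun k _ => ?_
      rw [hG.christoffel_symm hz k j l]
      ring
  have e4 : ∑ i, ∑ p, christoffel G i i p z * halfGradEnergy G f c p z
      = ∑ k, ∑ i, ∑ p, christoffel G i i p z * W k p z * V k z
        + c * f z * ∑ j, ∑ l, christoffel G j j l z * V l z := by
    simp only [halfGradEnergy, ← hVdef, ← hWdef, mul_add, Finset.mul_sum, Finset.sum_add_distrib]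
    congr 1
    · conv_rhs => rw [Finset.sum_comm]
      refine Finset.sum_congr rfl fun i _ => ?_
      rw [Finset.sum_comm]
      exact Finset.sum_congr rfl fun l _ => Finset.sum_congr rfl fun k _ => by ring
    · exact Finset.sum_congr rfl fun l _ => Finset.sum_congr rfl fun k _ => by ring
  have e5 : ∑ j, partialDeriv j f z * V j z = gradNormSqCoord G f z :=
    Finset.sum_congr rfl fun j _ => mul_comm _ _
  have e6 : ∑ k, ∑ l, ricciCoord G k l z * V l z * V k z
      = ∑ j, ∑ k, ricciCoord G j k z * V j z * V k z :=
    Finset.sum_congr rfl fun l _ => Finset.sum_congr rfl fun k _ => by ring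
  simp only [hD, Finset.sum_add_distrib, ← Finset.mul_sum, e2, e3, e4, e5, e1, add_mul, sub_mul,
    Finset.sum_sub_distrib, Finset.sum_mul, e6, mul_assoc (-lam)]
  ring

/-- At a maximum point of `|∇f|² + c f²`, where `∇f ≠ 0`, `(c - lam)(|∇f|² + c f²) ≤ 0`. -/
theorem sub_mul_energy_nonpos (hG : IsLocalMetric S G) (hf : ContDiffOn ℝ ∞ f S) (hz : z ∈ S)
    (heig : ∀ y ∈ S, laplacianCoord G f y = -lam * f y)
    (hRic : ∀ v : Fin n → ℝ, 0 ≤ ∑ j, ∑ k, ricciCoord G j k z * v j * v k)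
    (hmax : ∀ y ∈ S, energy G f c y ≤ energy G f c z)
    (hbdry : z 0 = 0 → 0 ≤ halfGradEnergy G f c 0 z)
    (hgrad : gradNormSqCoord G f z ≠ 0) :
    (c - lam) * energy G f c z ≤ 0 := by
  have hcrit := hG.partialDeriv_energy_eq_zero hf hz hmax hbdry
  have hY : ∀ j, halfGradEnergy G f c j z = 0 := fun j => by
    have := hG.sum_inv_mul_partialDeriv_energy (c := c) hf hz j
    simp only [hcrit, mul_zero, Finset.sum_const_zero] at this
    linarith
  have h1 := hG.sum_partialDeriv_halfGradEnergy_nonpos hf hz hmax hcrit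
  have h2 := hG.sum_partialDeriv_halfGradEnergy (c := c) hf hz heig
  have h3 := hRic fun k => gradCoord G f k z
  have h4 : (-(c * f z)) ^ 2 ≤
      ∑ k, ∑ j, covDeriv G (gradCoord G f) k j z * covDeriv G (gradCoord G f) j k z := by
    have h := sq_le_trace_sq_of_eigenvector (hG.posDef z hz)
      (W := Matrix.of fun k j => covDeriv G (gradCoord G f) k j z)
      (V := fun k => gradCoord G f k z) (μ := -(c * f z)) ?_ ?_ ?_
    · simpa [Matrix.trace, Matrix.mul_apply] using h
    · ext i j
      simp only [Matrix.transpose_apply, Matrix.mul_apply, Matrix.of_apply]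
      rw [← hG.hessianCoord_eq hf hz, ← hG.hessianCoord_eq hf hz, hG.hessianCoord_symm hf hz]
    · intro h0
      refine hgrad (Finset.sum_eq_zero fun k _ => ?_)
      rw [congrFun h0 k, Pi.zero_apply, zero_mul]
    · ext j
      have := hY j
      unfold halfGradEnergy at this
      simp only [Matrix.vecMul, dotProduct, Matrix.of_apply, Pi.smul_apply, smul_eq_mul]
      rw [Finset.sum_congr rfl fun k _ => mul_comm (gradCoord G f k z) _]
      linarith
  simp only [hY, mul_zero, Finset.sum_const_zero, add_zero] at h2
  unfold energy
  nlinarith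

/-! #### The boundary -/

theorem invSqrtInv_pos (hG : IsLocalMetric S G) (hz : z ∈ S) : 0 < invSqrtInv G z :=
  inv_pos.2 (Real.sqrt_pos.2 (hG.inv_zero_zero_pos hz))

theorem contDiffOn_invSqrtInv (hG : IsLocalMetric S G) : ContDiffOn ℝ ∞ (invSqrtInv G) S :=
  ((hG.contDiffOn_inv 0 0).sqrt fun _ hz => (hG.inv_zero_zero_pos hz).ne').inv
    fun _ hz => (Real.sqrt_pos.2 (hG.inv_zero_zero_pos hz)).ne'

theorem invSqrtInv_sq_mul (hG : IsLocalMetric S G) (hz : z ∈ S) :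
    invSqrtInv G z ^ 2 * (G z)⁻¹ 0 0 = 1 := by
  have h := hG.inv_zero_zero_pos hz
  rw [invSqrtInv, inv_pow, Real.sq_sqrt h.le, inv_mul_cancel₀ h.ne']

theorem outwardNormal_eq (k : Fin n) (z : EuclideanSpace ℝ (Fin n)) :
    outwardNormal G k z = -1 * ((G z)⁻¹ k 0 * invSqrtInv G z) := by
  rw [outwardNormal, invSqrtInv]
  ring

theorem contDiffOn_outwardNormal (hG : IsLocalMetric S G) (k : Fin n) :
    ContDiffOn ℝ ∞ (outwardNormal G k) S :=
  (contDiffOn_const.mul ((hG.contDiffOn_inv k 0).mul hG.contDiffOn_invSqrtInv)).congr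
    fun z _ => outwardNormal_eq k z

theorem sum_outwardNormal_mul (hG : IsLocalMetric S G) (hz : z ∈ S) (j : Fin n) :
    ∑ k, outwardNormal G k z * G z k j = (if j = 0 then -1 else 0) * invSqrtInv G z := by
  have h : ∑ k, outwardNormal G k z * G z k j
      = -1 * invSqrtInv G z * ∑ k, G z j k * (G z)⁻¹ k 0 := by
    rw [Finset.mul_sum]
    exact Finset.sum_congr rfl fun k _ => by rw [outwardNormal_eq, hG.symm hz k j]; ring
  rw [h, hG.sum_mul_inv hz]
  split_ifs <;> ring

theorem covDerivNormal_eq (hG : IsLocalMetric S G) (hz : z ∈ S) (i j : Fin n) :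
    covDerivNormal G i j z = christoffel G 0 i j z * invSqrtInv G z
      + (if j = 0 then -1 else 0) * partialDeriv i (invSqrtInv G) z := by
  have hR := hG.relOpen
  have hν := hG.contDiffOn_outwardNormal
  have h1 : ∑ k, (partialDeriv i (outwardNormal G k) z * G z k j
      + outwardNormal G k z * partialDeriv i (fun y => G y k j) z)
      = (if j = 0 then -1 else 0) * partialDeriv i (invSqrtInv G) z := by
    rw [← hR.partialDeriv_const_mul _ hG.contDiffOn_invSqrtInv hz,
      ← hR.partialDeriv_congr (fun y hy => hG.sum_outwardNormal_mul hy j) hz,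
      hR.partialDeriv_sum (fun k => (hν k).mul (hG.contDiffOn k j)) hz]
    exact Finset.sum_congr rfl fun k _ =>
      (hR.partialDeriv_mul (hν k) (hG.contDiffOn k j) hz i).symm
  have h2 : ∑ k, outwardNormal G k z * ∑ p, christoffel G p i j z * G z p k
      = -(christoffel G 0 i j z * invSqrtInv G z) := by
    have : ∀ p, ∑ k, outwardNormal G k z * (christoffel G p i j z * G z p k)
        = christoffel G p i j z * ((if p = 0 then -1 else 0) * invSqrtInv G z) := fun p => by
      rw [← hG.sum_outwardNormal_mul hz p, Finset.mul_sum]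
      exact Finset.sum_congr rfl fun k _ => by rw [hG.symm hz p k]; ring
    simp only [Finset.mul_sum]
    rw [Finset.sum_comm]
    simp [this]
  have h3 : ∑ k, outwardNormal G k z * ∑ p, christoffel G p i k z * G z p j
      = ∑ k, (∑ l, christoffel G k i l z * outwardNormal G l z) * G z k j := by
    simp only [Finset.mul_sum, Finset.sum_mul]
    rw [Finset.sum_comm]
    exact Finset.sum_congr rfl fun p _ => Finset.sum_congr rfl fun k _ => by ring
  simp only [hG.partialDeriv_metric hz, mul_add, Finset.sum_add_distrib, h2, h3] at h1
  simp only [covDerivNormal, add_mul, Finset.sum_add_distrib]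
  linarith

/-- Convex boundary and Neumann condition: the normal derivative of `|∇f|² + c f²` has a sign. -/
theorem halfGradEnergy_nonneg_of_neumann (hG : IsLocalMetric S G) (hf : ContDiffOn ℝ ∞ f S)
    (hz : z ∈ S) (hz0 : z 0 = 0)
    (hneu : ∀ y ∈ S, y 0 = 0 → ∑ k, outwardNormal G k y * partialDeriv k f y = 0)
    (hconv : ∀ v : Fin n → ℝ, v 0 = 0 → 0 ≤ secondFundamentalForm G v z) :
    0 ≤ halfGradEnergy G f c 0 z := by
  have hV0 : ∀ y ∈ S, y 0 = 0 → gradCoord G f 0 y = 0 := by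
    intro y hy hy0
    have h : ∑ k, outwardNormal G k y * partialDeriv k f y
        = -(invSqrtInv G y) * gradCoord G f 0 y := by
      rw [gradCoord, Finset.mul_sum]
      exact Finset.sum_congr rfl fun k _ => by
        rw [outwardNormal_eq, hG.inv_symm hy k 0]; ring
    rw [hneu y hy hy0] at h
    exact (mul_eq_zero.1 h.symm).resolve_left (neg_ne_zero.2 (hG.invSqrtInv_pos hy).ne')
  have hVz := hV0 z hz hz0
  have h1 : halfGradEnergy G f c 0 z
      = ∑ i, ∑ j, gradCoord G f i z * gradCoord G f j z * christoffel G 0 i j z := by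
    rw [halfGradEnergy, hVz, mul_zero, mul_zero, add_zero]
    refine Finset.sum_congr rfl fun i _ => ?_
    have h : partialDeriv i (gradCoord G f 0) z * gradCoord G f i z = 0 := by
      by_cases hi : i = 0
      · rw [hi, hVz, mul_zero]
      · rw [hG.relOpen.partialDeriv_eq_zero_of_boundary (hG.contDiffOn_gradCoord hf 0) hz hz0
          hV0 hi, zero_mul]
    rw [covDeriv, add_mul, h, zero_add, Finset.sum_mul]
    exact Finset.sum_congr rfl fun j _ => by ring
  have h2 : secondFundamentalForm G (fun k => gradCoord G f k z) z
      = invSqrtInv G z * halfGradEnergy G f c 0 z := by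
    rw [h1, secondFundamentalForm]
    simp only [Finset.mul_sum]
    refine Finset.sum_congr rfl fun i _ => Finset.sum_congr rfl fun j _ => ?_
    rw [hG.covDerivNormal_eq hz]
    by_cases hj : j = 0
    · simp [hj, hVz]
    · simp only [hj, if_false]
      ring
  have h3 := hconv (fun k => gradCoord G f k z) hVz
  rw [h2] at h3
  exact nonneg_of_mul_nonneg_right h3 (hG.invSqrtInv_pos hz)

/-- Mean convex boundary and Dirichlet condition: the normal derivative of `|∇f|² + c f²` has a
sign. -/
theorem halfGradEnergy_nonneg_of_dirichlet (hG : IsLocalMetric S G) (hf : ContDiffOn ℝ ∞ f S)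
    (hz : z ∈ S) (hz0 : z 0 = 0) (heig : laplacianCoord G f z = -lam * f z)
    (hdir : ∀ y ∈ S, y 0 = 0 → f y = 0) (hmean : 0 ≤ meanCurvature G z) :
    0 ≤ halfGradEnergy G f c 0 z := by
  have hR := hG.relOpen
  have hfz := hdir z hz hz0
  have hd : ∀ y ∈ S, y 0 = 0 → ∀ i ≠ 0, partialDeriv i f y = 0 := fun y hy hy0 i hi =>
    hR.partialDeriv_eq_zero_of_boundary hf hy hy0 hdir hi
  have hdd : ∀ i ≠ 0, ∀ j ≠ 0, partialDeriv i (partialDeriv j f) z = 0 := fun i hi j hj =>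
    hR.partialDeriv_eq_zero_of_boundary (hR.contDiffOn_partialDeriv hf j) hz hz0
      (fun y hy hy0 => hd y hy hy0 j hj) hi
  set ρ := invSqrtInv G z with hρ
  have hρ0 : 0 < ρ := hG.invSqrtInv_pos hz
  have hρ2 : ρ ^ 2 * (G z)⁻¹ 0 0 = 1 := hG.invSqrtInv_sq_mul hz
  set b := partialDeriv 0 f z with hb
  have hV : ∀ k, gradCoord G f k z = (G z)⁻¹ k 0 * b := fun k => by
    rw [gradCoord, Finset.sum_eq_single 0 (fun l _ hl => by rw [hd z hz hz0 l hl, mul_zero])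
      (by simp)]
  set P : Fin n → Fin n → ℝ := fun i j =>
    (G z)⁻¹ i j - outwardNormal G i z * outwardNormal G j z with hP
  have hP' : ∀ i j, P i j = (G z)⁻¹ i j - ρ ^ 2 * ((G z)⁻¹ i 0 * (G z)⁻¹ j 0) := fun i j => by
    simp only [hP, outwardNormal_eq, ← hρ]
    ring
  have hP0 : ∀ i, P i 0 = 0 := fun i => by
    rw [hP']
    linear_combination (-(G z)⁻¹ i 0) * hρ2
  have hP0' : ∀ j, P 0 j = 0 := fun j => by
    rw [hP', hG.inv_symm hz 0 j]
    linear_combination (-(G z)⁻¹ j 0) * hρ2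
  have hmc : meanCurvature G z = ρ * ∑ i, ∑ j, P i j * christoffel G 0 i j z := by
    rw [meanCurvature]
    simp only [Finset.mul_sum]
    refine Finset.sum_congr rfl fun i _ => Finset.sum_congr rfl fun j _ => ?_
    change P i j * _ = _
    rw [hG.covDerivNormal_eq hz]
    by_cases hj : j = 0
    · simp [hj, hP0]
    · simp only [hj, if_false, ← hρ]
      ring
  have hPH : ∑ i, ∑ j, P i j * hessianCoord G f i j z
      = -b * ∑ i, ∑ j, P i j * christoffel G 0 i j z := by
    simp only [Finset.mul_sum]
    refine Finset.sum_congr rfl fun i _ => Finset.sum_congr rfl fun j _ => ?_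
    by_cases hi : i = 0
    · simp [hi, hP0']
    by_cases hj : j = 0
    · simp [hj, hP0]
    rw [hessianCoord, hdd i hi j hj, Finset.sum_eq_single 0
      (fun l _ hl => by rw [hd z hz hz0 l hl, mul_zero]) (by simp)]
    ring
  have hPH' : ∑ i, ∑ j, P i j * hessianCoord G f i j z
      = laplacianCoord G f z
        - ρ ^ 2 * ∑ i, ∑ j, (G z)⁻¹ i 0 * (G z)⁻¹ j 0 * hessianCoord G f i j z := by
    simp only [laplacianCoord, hP', sub_mul, Finset.sum_sub_distrib, Finset.mul_sum, mul_assoc]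
  have hY : halfGradEnergy G f c 0 z
      = b * ∑ i, ∑ j, (G z)⁻¹ i 0 * (G z)⁻¹ j 0 * hessianCoord G f i j z := by
    rw [halfGradEnergy, hfz, zero_mul, mul_zero, add_zero,
      ← hG.sum_inv_mul_hessianCoord_mul hf hz]
    simp only [Finset.mul_sum, hV]
    exact Finset.sum_congr rfl fun i _ => Finset.sum_congr rfl fun j _ => by
      rw [hG.inv_symm hz 0 i]; ring
  rw [hPH, heig, hfz, mul_zero, zero_sub] at hPH'
  have key : ρ ^ 3 * halfGradEnergy G f c 0 z = b ^ 2 * meanCurvature G z := by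
    rw [hY, hmc]
    linear_combination (b * ρ) * hPH'
  have : 0 ≤ ρ ^ 3 * halfGradEnergy G f c 0 z := by rw [key]; positivity
  exact nonneg_of_mul_nonneg_right this (by positivity)

end IsLocalMetric

end MaximumPoint

section Charts

variable {n : ℕ} [NeZero n] {M : Type*} [TopologicalSpace M]
  [ChartedSpace (EuclideanHalfSpace n) M]

theorem isRelOpen_extChartAt_target (x₀ : M) : IsRelOpen (extChartAt (𝓡∂ n) x₀).target where
  subset := extChartAt_target_subset_range x₀
  mem_nhdsWithin _ hz := extChartAt_target_mem_nhdsWithin_of_mem hz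

/-- The differential at `z` of the inverse of the chart around `x₀`. -/
def coordDeriv (x₀ : M) (z : EuclideanSpace ℝ (Fin n)) :
    EuclideanSpace ℝ (Fin n) →L[ℝ] TangentSpace (𝓡∂ n) ((extChartAt (𝓡∂ n) x₀).symm z) :=
  mfderivWithin 𝓘(ℝ, EuclideanSpace ℝ (Fin n)) (𝓡∂ n) (extChartAt (𝓡∂ n) x₀).symm
    (Set.range (𝓡∂ n)) z

theorem coordDeriv_eq_sum (x₀ : M) (z : EuclideanSpace ℝ (Fin n))
    (v : EuclideanSpace ℝ (Fin n)) :
    coordDeriv x₀ z v = ∑ i, v i • coordVector (chartAt (EuclideanHalfSpace n) x₀) i z := by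
  have hv : v = ∑ i, v i • EuclideanSpace.single i (1 : ℝ) := by
    ext j
    simp [Finset.sum_apply, Pi.single_apply]
  conv_lhs => rw [hv, map_sum]
  simp only [map_smul]
  rfl

variable [IsManifold (𝓡∂ n) ∞ M]

theorem contDiffOn_coordFun {u : M → ℝ} (hu : ContMDiff (𝓡∂ n) 𝓘(ℝ, ℝ) ∞ u) (x₀ : M) :
    ContDiffOn ℝ ∞ (coordFun (chartAt (EuclideanHalfSpace n) x₀) u)
      (extChartAt (𝓡∂ n) x₀).target :=
  contMDiffOn_iff_contDiffOn.1 (hu.comp_contMDiffOn (contMDiffOn_extChartAt_symm x₀))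

theorem coordVector_eq (x₀ : M) {z : EuclideanSpace ℝ (Fin n)}
    (hz : z ∈ (extChartAt (𝓡∂ n) x₀).target) (i : Fin n) :
    coordVector (chartAt (EuclideanHalfSpace n) x₀) i z
      = (trivializationAt (EuclideanSpace ℝ (Fin n)) (TangentSpace (𝓡∂ n)) x₀).symmL ℝ
        ((extChartAt (𝓡∂ n) x₀).symm z) (EuclideanSpace.single i 1) := by
  have hx : (extChartAt (𝓡∂ n) x₀).symm z ∈ (chartAt (EuclideanHalfSpace n) x₀).source := by
    simpa using (extChartAt (𝓡∂ n) x₀).map_target hz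
  rw [TangentBundle.symmL_trivializationAt hx, (extChartAt (𝓡∂ n) x₀).right_inv hz]
  rfl

theorem contDiffOn_coordMetric (g : Metric n M) (x₀ : M) (i j : Fin n) :
    ContDiffOn ℝ ∞ (fun z => coordMetric g (chartAt (EuclideanHalfSpace n) x₀) z i j)
      (extChartAt (𝓡∂ n) x₀).target := by
  set e := trivializationAt (EuclideanSpace ℝ (Fin n)) (TangentSpace (𝓡∂ n) (M := M)) x₀ with he
  have hX : ∀ v : EuclideanSpace ℝ (Fin n),
      ContMDiffOn (𝓡∂ n) ((𝓡∂ n).prod 𝓘(ℝ, EuclideanSpace ℝ (Fin n))) ∞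
        (fun m : M => Bundle.TotalSpace.mk' (EuclideanSpace ℝ (Fin n)) m (e.symmL ℝ m v))
        e.baseSet := by
    intro v
    have h1 := (e.contMDiffOn_symm (IB := 𝓡∂ n) (n := ∞))
    have h2 : ContMDiffOn (𝓡∂ n) ((𝓡∂ n).prod 𝓘(ℝ, EuclideanSpace ℝ (Fin n))) ∞
        (fun m : M => (m, v)) e.baseSet := (contMDiff_id.prodMk contMDiff_const).contMDiffOn
    refine (h1.comp h2 fun m hm => by simpa [e.target_eq] using hm).congr fun m hm => ?_
    rw [Function.comp_apply, ← e.mk_symm hm v]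
    exact congrArg (Bundle.TotalSpace.mk m) (e.symmL_apply hm v)
  have hg : ContMDiffOn (𝓡∂ n) 𝓘(ℝ, ℝ) ∞ (fun m : M => g.inner m
      (e.symmL ℝ m (EuclideanSpace.single i 1)) (e.symmL ℝ m (EuclideanSpace.single j 1)))
      e.baseSet := by
    intro m hm
    have h := ContMDiffWithinAt.clm_bundle_apply₂ (F₁ := EuclideanSpace ℝ (Fin n))
      (F₂ := EuclideanSpace ℝ (Fin n)) (F₃ := ℝ) (E₃ := Bundle.Trivial M ℝ) (b := id) (ψ := g.inner)
      g.contMDiff.contMDiffAt.contMDiffWithinAt (hX (EuclideanSpace.single i 1) m hm)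
      (hX (EuclideanSpace.single j 1) m hm)
    exact (Bundle.contMDiffWithinAt_totalSpace.1 h).2
  refine contMDiffOn_iff_contDiffOn.1 ((hg.comp (contMDiffOn_extChartAt_symm x₀) ?_).congr ?_)
  · intro z hz
    simpa [he] using (extChartAt (𝓡∂ n) x₀).map_target hz
  · intro z hz
    simp only [coordMetric, Matrix.of_apply, coordVector_eq x₀ hz]
    rfl

theorem bijective_coordDeriv (x₀ : M) {z : EuclideanSpace ℝ (Fin n)}
    (hz : z ∈ (extChartAt (𝓡∂ n) x₀).target) : Function.Bijective (coordDeriv x₀ z) :=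
  (isInvertible_mfderivWithin_extChartAt_symm hz).bijective

theorem inner_sum_smul (g : Metric n M) (x : M) (X : Fin n → TangentSpace (𝓡∂ n) x)
    (v w : Fin n → ℝ) :
    g.inner x (∑ i, v i • X i) (∑ j, w j • X j)
      = ∑ i, ∑ j, v i * w j * g.inner x (X i) (X j) := by
  conv_rhs => rw [Finset.sum_comm]
  rw [map_sum]
  refine Finset.sum_congr rfl fun j _ => ?_
  rw [map_smul, map_sum, sum_apply, Finset.smul_sum]
  refine Finset.sum_congr rfl fun i _ => ?_
  rw [map_smul, smul_apply, smul_eq_mul, smul_eq_mul]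
  ring

theorem inner_coordDeriv (g : Metric n M) (x₀ : M) (z v w : EuclideanSpace ℝ (Fin n)) :
    g.inner _ (coordDeriv x₀ z v) (coordDeriv x₀ z w)
      = ∑ i, ∑ j, v i * w j * coordMetric g (chartAt (EuclideanHalfSpace n) x₀) z i j := by
  rw [coordDeriv_eq_sum, coordDeriv_eq_sum]
  exact inner_sum_smul g _ (fun i => coordVector (chartAt (EuclideanHalfSpace n) x₀) i z) _ _

theorem isLocalMetric_coordMetric (g : Metric n M) (x₀ : M) :
    IsLocalMetric (extChartAt (𝓡∂ n) x₀).target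
      (coordMetric g (chartAt (EuclideanHalfSpace n) x₀)) where
  relOpen := isRelOpen_extChartAt_target x₀
  contDiffOn := contDiffOn_coordMetric g x₀
  posDef z hz := by
    refine Matrix.PosDef.of_dotProduct_mulVec_pos ?_ fun v hv => ?_
    · ext i j
      simp only [Matrix.conjTranspose_apply, coordMetric, Matrix.of_apply, star_trivial]
      exact g.symm _ _ _
    · have h1 := inner_coordDeriv g x₀ z (WithLp.toLp 2 v) (WithLp.toLp 2 v)
      have h2 : coordDeriv x₀ z (WithLp.toLp 2 v) ≠ 0 := by
        rw [← map_zero (coordDeriv x₀ z), (bijective_coordDeriv x₀ hz).1.ne_iff]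
        simpa using hv
      have h3 := g.pos _ _ h2
      rw [h1] at h3
      refine h3.trans_eq ?_
      simp only [dotProduct, Matrix.mulVec, Finset.mul_sum, star_trivial]
      exact Finset.sum_congr rfl fun i _ => Finset.sum_congr rfl fun j _ => by ring

theorem mfderiv_coordDeriv {u : M → ℝ} (hu : ContMDiff (𝓡∂ n) 𝓘(ℝ, ℝ) ∞ u) (x₀ : M)
    {z : EuclideanSpace ℝ (Fin n)} (hz : z ∈ (extChartAt (𝓡∂ n) x₀).target)
    (v : EuclideanSpace ℝ (Fin n)) :
    (mfderiv (𝓡∂ n) 𝓘(ℝ, ℝ) u ((extChartAt (𝓡∂ n) x₀).symm z) (coordDeriv x₀ z v) : ℝ)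
      = ∑ i, v i * partialDeriv i (coordFun (chartAt (EuclideanHalfSpace n) x₀) u) z := by
  rw [← fderivWithin_eq_sum_partialDeriv, ← mfderivWithin_eq_fderivWithin]
  change _ = mfderivWithin _ _ (u ∘ (extChartAt (𝓡∂ n) x₀).symm) _ _ _
  rw [mfderiv_comp_mfderivWithin _ (hu.mdifferentiableAt (by simp))
    (mdifferentiableWithinAt_extChartAt_symm hz)
    ((isRelOpen_extChartAt_target x₀).uniqueDiffWithinAt hz).uniqueMDiffWithinAt]
  rfl

theorem gradNormSq_eq (g : Metric n M) {u : M → ℝ} (hu : ContMDiff (𝓡∂ n) 𝓘(ℝ, ℝ) ∞ u) (x₀ : M)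
    {z : EuclideanSpace ℝ (Fin n)} (hz : z ∈ (extChartAt (𝓡∂ n) x₀).target) :
    gradNormSq g u ((extChartAt (𝓡∂ n) x₀).symm z)
      = gradNormSqCoord (coordMetric g (chartAt (EuclideanHalfSpace n) x₀))
        (coordFun (chartAt (EuclideanHalfSpace n) x₀) u) z := by
  have hG := isLocalMetric_coordMetric g x₀
  set G := coordMetric g (chartAt (EuclideanHalfSpace n) x₀) with hGdef
  set f := coordFun (chartAt (EuclideanHalfSpace n) x₀) u with hf
  obtain ⟨N, hN⟩ := (bijective_coordDeriv x₀ hz).2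
    (gradient g u ((extChartAt (𝓡∂ n) x₀).symm z))
  have h1 : ∀ l, partialDeriv l f z = ∑ i, N i * G z i l := by
    intro l
    have h := inner_gradient g u _ (coordDeriv x₀ z (EuclideanSpace.single l 1))
    rw [mfderiv_coordDeriv hu x₀ hz, ← hN, inner_coordDeriv] at h
    simpa [Pi.single_apply] using h.symm
  have h2 : ∀ k, gradCoord G f k z = N k := by
    intro k
    simp only [gradCoord, h1, Finset.mul_sum]
    rw [Finset.sum_comm]
    have : ∀ i, ∑ l, (G z)⁻¹ k l * (N i * G z i l) = N i * if k = i then 1 else 0 := fun i => by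
      rw [← hG.sum_inv_mul hz k i, Finset.mul_sum]
      exact Finset.sum_congr rfl fun l _ => by rw [hG.symm hz i l]; ring
    simp [this]
  rw [gradNormSq, inner_gradient, ← hN, mfderiv_coordDeriv hu x₀ hz, gradNormSqCoord]
  simp only [h2]
  rfl

theorem continuous_gradNormSq (g : Metric n M) {u : M → ℝ}
    (hu : ContMDiff (𝓡∂ n) 𝓘(ℝ, ℝ) ∞ u) : Continuous (gradNormSq g u) := by
  rw [continuous_iff_continuousAt]
  intro x₀
  have h1 : ContinuousOn (fun x : M => gradNormSqCoord
      (coordMetric g (chartAt (EuclideanHalfSpace n) x₀))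
      (coordFun (chartAt (EuclideanHalfSpace n) x₀) u) (extChartAt (𝓡∂ n) x₀ x))
      (extChartAt (𝓡∂ n) x₀).source :=
    ((isLocalMetric_coordMetric g x₀).contDiffOn_gradNormSqCoord
      (contDiffOn_coordFun hu x₀)).continuousOn.comp (continuousOn_extChartAt x₀)
      (extChartAt (𝓡∂ n) x₀).mapsTo
  have hs : (extChartAt (𝓡∂ n) x₀).source ∈ 𝓝 x₀ := extChartAt_source_mem_nhds x₀
  refine (h1.continuousAt hs).congr ?_
  filter_upwards [hs] with x hx
  rw [← gradNormSq_eq g hu x₀ ((extChartAt (𝓡∂ n) x₀).map_source hx),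
    (extChartAt (𝓡∂ n) x₀).left_inv hx]

theorem extChartAt_symm_mem_boundary (x₀ : M) {z : EuclideanSpace ℝ (Fin n)}
    (hz : z ∈ (extChartAt (𝓡∂ n) x₀).target) (hz0 : z 0 = 0) :
    (extChartAt (𝓡∂ n) x₀).symm z ∈ (𝓡∂ n).boundary M := by
  have hx : (extChartAt (𝓡∂ n) x₀).symm z ∈ (chartAt (EuclideanHalfSpace n) x₀).source := by
    simpa using (extChartAt (𝓡∂ n) x₀).map_target hz
  refine ((𝓡∂ n).isBoundaryPoint_iff_of_mem_atlas (n := ∞) (by simp)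
    (chart_mem_atlas _ x₀) hx).2 ?_
  change extChartAt (𝓡∂ n) x₀ _ ∈ frontier (extChartAt (𝓡∂ n) x₀).target
  rw [(extChartAt (𝓡∂ n) x₀).right_inv hz]
  refine ⟨subset_closure hz, fun h => ?_⟩
  have h2 := interior_mono (extChartAt_target_subset_range x₀) h
  rw [range_halfSpace, interior_halfSpace] at h2
  exact absurd hz0 (ne_of_gt h2)

/-- At a maximum point of `|∇u|² + c u²` with `∇u ≠ 0`, one has `(c - lam)(|∇u|² + c u²) ≤ 0`. -/
theorem sub_mul_nonpos_of_isMax (g : Metric n M) (hRic : NonnegRicci g)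
    {u : M → ℝ} (hu : ContMDiff (𝓡∂ n) 𝓘(ℝ, ℝ) ∞ u) {lam : ℝ} (heig : IsEigenfunction g lam u)
    (hbdry : (ConvexBoundary g ∧ NeumannCondition g u) ∨
      (MeanConvexBoundary g ∧ ∀ x ∈ (𝓡∂ n).boundary M, u x = 0))
    {c : ℝ} {p : M}
    (hp : ∀ x, gradNormSq g u x + c * u x ^ 2 ≤ gradNormSq g u p + c * u p ^ 2)
    (hgrad : gradNormSq g u p ≠ 0) :
    (c - lam) * (gradNormSq g u p + c * u p ^ 2) ≤ 0 := by
  set e := chartAt (EuclideanHalfSpace n) p with he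
  have hem : e ∈ IsManifold.maximalAtlas (𝓡∂ n) ∞ M := IsManifold.chart_mem_maximalAtlas p
  set φ := extChartAt (𝓡∂ n) p with hφ
  have hG := isLocalMetric_coordMetric g p
  have hf := contDiffOn_coordFun hu p
  have hsource : ∀ z ∈ φ.target, φ.symm z ∈ e.source := fun z hz => by
    simpa [hφ] using φ.map_target hz
  have hinv : ∀ z ∈ φ.target, e.extend (𝓡∂ n) (φ.symm z) = z := fun z hz => φ.right_inv hz
  have hz : φ p ∈ φ.target := mem_extChartAt_target p
  have hzp : φ.symm (φ p) = p := extChartAt_to_inv p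
  have henergy : ∀ z ∈ φ.target, energy (coordMetric g e) (coordFun e u) c z
      = gradNormSq g u (φ.symm z) + c * u (φ.symm z) ^ 2 := fun z hz => by
    rw [energy, ← gradNormSq_eq g hu p hz, pow_two]
    rfl
  have hlap : ∀ z ∈ φ.target,
      laplacianCoord (coordMetric g e) (coordFun e u) z = -lam * coordFun e u z := fun z hz => by
    have h := heig e hem _ (hsource z hz)
    rwa [hinv z hz] at h
  have hpe : p ∈ e.source := mem_chart_source _ p
  have hmain := hG.sub_mul_energy_nonpos (c := c) (lam := lam) hf hz hlap
    (hRic e hem p hpe) (fun y hy => ?_) (fun h0 => ?_) ?_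
  · rwa [henergy _ hz, hzp] at hmain
  · rw [henergy y hy, henergy _ hz, hzp]
    exact hp _
  · have hpb : p ∈ (𝓡∂ n).boundary M := by
      have := extChartAt_symm_mem_boundary p hz h0
      rwa [hzp] at this
    rcases hbdry with ⟨hconv, hneu⟩ | ⟨hmean, hdir⟩
    · refine hG.halfGradEnergy_nonneg_of_neumann hf hz h0 (fun y hy hy0 => ?_)
        (hconv e hem p hpe hpb)
      have h := hneu e hem _ (hsource y hy) (extChartAt_symm_mem_boundary p hy hy0)
      rwa [hinv y hy] at h
    · exact hG.halfGradEnergy_nonneg_of_dirichlet hf hz h0 (hlap _ hz)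
        (fun y hy hy0 => hdir _ (extChartAt_symm_mem_boundary p hy hy0)) (hmean e hem p hpe hpb)
  · rwa [← gradNormSq_eq g hu p hz, hzp]

theorem gradNormSq_le_mul [CompactSpace M] (g : Metric n M) (hRic : NonnegRicci g)
    {u : M → ℝ} (hu : ContMDiff (𝓡∂ n) 𝓘(ℝ, ℝ) ∞ u) {lam : ℝ} (hlam : 0 < lam)
    (heig : IsEigenfunction g lam u) (hle : ∀ x, |u x| ≤ 1)
    (hbdry : (ConvexBoundary g ∧ NeumannCondition g u) ∨
      (MeanConvexBoundary g ∧ ∀ x ∈ (𝓡∂ n).boundary M, u x = 0))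
    {β : ℝ} (hβ : 1 < β) (x : M) : gradNormSq g u x ≤ lam * (β - u x ^ 2) := by
  have hpos : ∀ y, 0 < β - u y ^ 2 := fun y => by
    have := (sq_le_one_iff_abs_le_one (u y)).2 (hle y)
    linarith
  have hcont : Continuous fun y => gradNormSq g u y / (β - u y ^ 2) :=
    (continuous_gradNormSq g hu).div (continuous_const.sub (hu.continuous.pow 2))
      fun y => (hpos y).ne'
  obtain ⟨p, -, hp⟩ := isCompact_univ.exists_isMaxOn ⟨x, mem_univ x⟩ hcont.continuousOn
  set c := gradNormSq g u p / (β - u p ^ 2) with hc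
  have hcx : ∀ y, gradNormSq g u y ≤ c * (β - u y ^ 2) := fun y =>
    (div_le_iff₀ (hpos y)).1 (hp (mem_univ y))
  have hcp : gradNormSq g u p = c * (β - u p ^ 2) := by
    rw [hc, div_mul_cancel₀ _ (hpos p).ne']
  suffices h : c ≤ lam from (hcx x).trans (mul_le_mul_of_nonneg_right h (hpos x).le)
  by_contra! hlt
  have hc0 : 0 < c := hlam.trans hlt
  have h := sub_mul_nonpos_of_isMax g hRic hu heig hbdry (c := c) (p := p)
    (fun y => by linarith [hcx y]) (by rw [hcp]; exact (mul_pos hc0 (hpos p)).ne')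
  have h2 : gradNormSq g u p + c * u p ^ 2 = c * β := by rw [hcp]; ring
  rw [h2] at h
  have h3 : 0 < (c - lam) * (c * β) :=
    mul_pos (by linarith) (mul_pos hc0 (by linarith))
  linarith

end Charts

end LiYau

end

theorem theorem2p4 {n : ℕ} [NeZero n] {M : Type*} [TopologicalSpace M] [T2Space M]
    [CompactSpace M] [ChartedSpace (EuclideanHalfSpace n) M] [IsManifold (𝓡∂ n) ∞ M]
    (g : LiYau.Metric n M) (hRic : LiYau.NonnegRicci g)
    (u : M → ℝ) (hu : ContMDiff (𝓡∂ n) 𝓘(ℝ, ℝ) ∞ u)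
    (lam : ℝ) (hlam : 0 < lam) (heig : LiYau.IsEigenfunction g lam u)
    (hmax : IsGreatest (Set.range fun x => |u x|) 1)
    (hbdry : (LiYau.ConvexBoundary g ∧ LiYau.NeumannCondition g u) ∨
      (LiYau.MeanConvexBoundary g ∧ ∀ x ∈ (𝓡∂ n).boundary M, u x = 0)) :
    ∀ x : M, LiYau.gradNormSq g u x + lam * u x ^ 2 ≤ lam := by
  intro x
  refine le_of_forall_pos_le_add fun ε hε => ?_
  have h := LiYau.gradNormSq_le_mul g hRic hu hlam heig (fun y => hmax.2 ⟨y, rfl⟩) hbdry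
    (β := 1 + ε / lam) (by linarith [div_pos hε hlam]) x
  have h2 : lam * (ε / lam) = ε := mul_div_cancel₀ ε hlam.ne'
  linarith
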